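/- Let $p$ be a prime and let $G$ be a non-trivial finite $p$-group that can be generated by two elements, of exponent $p^e$ (so $e\ge 1$). For $n\ge 1$ let $G^n$ denote the subgroup generated by all $n$-th powers of elements of $G$. Suppose that one of the following conditions holds: (i) $G$ is semi-$p^{e-1}$-abelian, i.e. for all $x,y\in G$ we have $x^{p^{e-1}}=y^{p^{e-1}}$ if and only if $(xy^{-1})^{p^{e-1}}=1$; (ii) $G$ is potent, i.e. $\gamma_{p-1}(G)\le G^p$ if $p$ is odd, and $G'\le G^4$ if $p=2$. For a group $H$ and $x,y\in H$ put $\Sigma(x,y)=\bigcup_{g\in H}\big(\langle x\rangle^g\cup\langle y\rangle^g\cup\langle xy\rangle^g\big)$. A Beauville structure of $H$ is a pair of generating sets $\{x_1,y_1\}$ and $\{x_2,y_2\}$ of $H$ such that $\Sigma(x_1,y_1)\cap\Sigma(x_2,y_2)=\{1\}$, and $H$ is a Beauville group if it has a Beauville structure. Then $G$ is a Beauville group if and only if $p\ge 5$ and $|G^{p^{e-1}}|\ge p^2$. If that is the case, then every lift of a Beauville structure of $G/\Phi(G)$ is a Beauville structure of $G$; that is, whenever $x_1,y_1,x_2,y_2\in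 G$ are such that their images in $G/\Phi(G)$ form a Beauville structure $\{\overline{x_1},\overline{y_1}\}$, $\{\overline{x_2},\overline{y_2}\}$ of $G/\Phi(G)$, where $\Phi(G)$ is the Frattini subgroup, the sets $\{x_1,y_1\}$ and $\{x_2,y_2\}$ form a Beauville structure of $G$. -/

import Mathlib

/-- `Σ(x, y)`: the union of all conjugates of the cyclic subgroups generated by `x`, `y`
and `x * y` (the conjugate `H ^ g` is `g⁻¹ H g`). -/
def beauvilleSigma {G : Type*} [Group G] (x y : G) : Set G :=
  ⋃ g : G, (fun h : G => g⁻¹ * h * g) ''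
    ((Subgroup.zpowers x : Set G) ∪ (Subgroup.zpowers y : Set G) ∪
      (Subgroup.zpowers (x * y) : Set G))

/-- The pairs `{x₁, y₁}` and `{x₂, y₂}` form an (unmixed) Beauville structure for `G`:
both generate `G`, and `Σ(x₁, y₁) ∩ Σ(x₂, y₂) = 1`. -/
def IsBeauvilleStructure {G : Type*} [Group G] (x₁ y₁ x₂ y₂ : G) : Prop :=
  Subgroup.closure {x₁, y₁} = ⊤ ∧ Subgroup.closure {x₂, y₂} = ⊤ ∧
    beauvilleSigma x₁ y₁ ∩ beauvilleSigma x₂ y₂ = {1}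

/-- A Beauville group is a group that possesses a Beauville structure. -/
def IsBeauvilleGroup (G : Type*) [Group G] : Prop :=
  ∃ x₁ y₁ x₂ y₂ : G, IsBeauvilleStructure x₁ y₁ x₂ y₂

/-- `G ^ n`: the subgroup generated by all `n`-th powers of elements of `G`. -/
def powerSubgroup (G : Type*) [Group G] (n : ℕ) : Subgroup G :=
  Subgroup.closure (Set.range fun g : G => g ^ n)

/-- `G` is semi-`p ^ i`-abelian. -/
def IsSemiPrimePowAbelian (p i : ℕ) (G : Type*) [Group G] : Prop :=
  ∀ x y : G, x ^ p ^ i = y ^ p ^ i ↔ (x * y⁻¹) ^ p ^ i = 1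

/-- The condition for a finite `p`-group to be potent: `γ_{p-1}(G) ≤ G ^ p` if `p` is odd, and
`G' ≤ G ^ 4` if `p = 2`. Mathlib's lower central series starts with `G` at index `0`, so that
`γ_{p-1}(G)` is its term of index `p - 2`. -/
def IsPotent (p : ℕ) (G : Type*) [Group G] : Prop :=
  (p ≠ 2 → (⊤ : Subgroup G).lowerCentralSeries (p - 2) ≤ powerSubgroup G p) ∧
    (p = 2 → commutator G ≤ powerSubgroup G 4)

/-!
Write `π` for the `p ^ (e - 1)`-th power map and `V = G ^ (p ^ (e - 1))`.

The key property is that elements with equal `π`-values are congruent modulo `Φ(G)`. It makes every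
Beauville structure of `G / Φ(G)` lift to `G` (`IsBeauvilleStructure.lift`): a nontrivial element of
`Σ(x₁, y₁) ∩ Σ(x₂, y₂)` has a power of order `p`, which is a `π`-value both of an element of
`Σ(x₁, y₁)` and of one of `Σ(x₂, y₂)`, both outside `Φ(G)`; these are then congruent modulo `Φ(G)`.
For `p ≥ 5` the quotient `G / Φ(G)` is a Beauville group as soon as `|V| ≥ p ^ 2`, since then `G` is
not cyclic.

If `G` is semi-`p ^ (e - 1)`-abelian, the elements killed by `π` form a normal subgroup `Ω`, and the
fibres of `π` are its cosets. As `G` is generated by two elements, `|V| ≥ p ^ 2` forces `Ω ≤ Φ(G)`,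
which is the key property. Conversely, for a Beauville group `G` the order of `V` cannot be `p`, and
the quotient `G / Ω`, of exponent `p`, is again a Beauville group, whereas nontrivial groups of
exponent `2` or `3` are not.

If `G` is potent, then either `π` is a homomorphism, so that `G` is semi-`p ^ (e - 1)`-abelian, or
`p ≥ 5`, `|V| ≥ p ^ 2` and the key property holds (`IsPotent.semi_or`). For odd `p` this rests on
Hall's formulas `(xy) ^ p ≡ x ^ p y ^ p` and `[x ^ p, y] ≡ [x, y] ^ p` modulo suitable terms,
obtained here from the theorem of Lazard and Leibman that polynomial sequences in a filtered group
form a group. They give `[γ_k(G) ^ p, G] = γ_{k+1}(G) ^ p` for potent `G`; hence `N = G ^ p` is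
powerful and the `p ^ (e - 2)`-th power map is a homomorphism on `N`. It follows that `π` is
multiplicative modulo `[V, G]` and commutes with commutators modulo `[V, G, G]`.
If `π(x) ∈ [V, G]` for some `x ∉ Φ(G)`, choose `y` with `G = ⟨x, y⟩`: then `[V, G]` is generated modulo `[V, G, G]` by
`[π(y), x] ≡ π([y, x]) ≡ [y, π(x)] ≡ 1`, so `[V, G] = 1` and `π` is a homomorphism. Otherwise `π`
modulo `[V, G]` separates the cosets of `Φ(G)`.
-/

open scoped commutatorElement

/-! ### Polynomial sequences in filtered groups -/

section PolynomialSequences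

variable {G : Type*} [Group G]

/-- A descending filtration `F 0 ≥ F 1 ≥ ⋯` of subgroups with `[F i, F j] ≤ F (i + j)`. The top
term `F 0` need not be the whole group. -/
structure IsCommFiltration (F : ℕ → Subgroup G) : Prop where
  anti : Antitone F
  comm : ∀ i j, ⁅F i, F j⁆ ≤ F (i + j)

/-- The sequence `f` is polynomial with respect to the filtration `F` shifted by `j`: for `k ≤ d`
its `k`-th difference (for the operator sending `f` to `f (n + 1) * (f n)⁻¹`) takes values in
`F (j + k)`. Cutting off at `d` differences makes induction on `d` possible, and makes it
unnecessary to assume that `F` reaches the trivial subgroup. -/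
def IsPolySeq (F : ℕ → Subgroup G) : ℕ → ℕ → (ℕ → G) → Prop
  | 0, j, f => ∀ n, f n ∈ F j
  | d + 1, j, f => (∀ n, f n ∈ F j) ∧ IsPolySeq F d (j + 1) fun n => f (n + 1) * (f n)⁻¹

namespace IsPolySeq

variable {F : ℕ → Subgroup G} {d i j : ℕ} {f g : ℕ → G}

lemma mem (hf : IsPolySeq F d j f) (n : ℕ) : f n ∈ F j := by
  cases d with
  | zero => exact hf n
  | succ d => exact hf.1 n

lemma of_succ (hf : IsPolySeq F (d + 1) j f) : IsPolySeq F d j f := by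
  induction d generalizing j f with
  | zero => exact hf.1
  | succ d ih => exact ⟨hf.1, ih hf.2⟩

lemma mono (hF : IsCommFiltration F) (hij : i ≤ j) (hf : IsPolySeq F d j f) :
    IsPolySeq F d i f := by
  induction d generalizing i j f with
  | zero => exact fun n => hF.anti hij (hf n)
  | succ d ih => exact ⟨fun n => hF.anti hij (hf.1 n), ih (Nat.succ_le_succ hij) hf.2⟩

lemma one : IsPolySeq F d j fun _ => 1 := by
  induction d generalizing j with
  | zero => exact fun _ => one_mem _
  | succ d ih => exact ⟨fun _ => one_mem _, by simpa using ih⟩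

/-- The theorem of Lazard and Leibman: polynomial sequences are closed under products and inverses.
The statement about commutators is needed for the induction on the number `d` of differences. -/
lemma mul_inv_commutator (hF : IsCommFiltration F) (d : ℕ) :
    (∀ i f g, IsPolySeq F d i f → IsPolySeq F d i g → IsPolySeq F d i fun n => f n * g n) ∧
    (∀ i f, IsPolySeq F d i f → IsPolySeq F d i fun n => (f n)⁻¹) ∧
    (∀ i j f g, IsPolySeq F d i f → IsPolySeq F d j g →
      IsPolySeq F d (i + j) fun n => ⁅f n, g n⁆) := by
  induction d with
  | zero =>
    exact ⟨fun i f g hf hg n => mul_mem (hf n) (hg n), fun i f hf n => inv_mem (hf n),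
      fun i j f g hf hg n => hF.comm i j (Subgroup.commutator_mem_commutator (hf n) (hg n))⟩
  | succ d ih =>
    obtain ⟨hmul, hinv, hcomm⟩ := ih
    refine ⟨fun i f g hf hg => ⟨fun n => mul_mem (hf.mem n) (hg.mem n), ?_⟩,
      fun i f hf => ⟨fun n => inv_mem (hf.mem n), ?_⟩, fun i j f g hf hg =>
      ⟨fun n => hF.comm i j (Subgroup.commutator_mem_commutator (hf.mem n) (hg.mem n)), ?_⟩⟩
    · have h1 := (hcomm _ _ _ _ hf.of_succ hg.2).mono hF (i := i + 1) (by omega)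
      convert hmul _ _ _ (hmul _ _ _ hf.2 h1) hg.2 using 2
      simp only [commutatorElement_def]
      group
    · have h1 := (hcomm _ _ _ _ (hinv _ _ hf.of_succ) (hinv _ _ hf.2)).mono hF
        (i := i + 1) (by omega)
      convert hmul _ _ _ h1 (hinv _ _ hf.2) using 2
      simp only [commutatorElement_def]
      group
    · -- with `a`, `b` the differences of `f`, `g` and `c = [f, g]`, the difference of `c` is
      -- `[a, [f, b g]] [f, b g] [a, b g] c⁻¹`, where `[f, b g] = [f, b] [b, c] c`
      have hf0 := hf.of_succ
      have hg0 := hg.of_succ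
      have hg1 := hmul _ _ _ (hg.2.mono hF (Nat.le_succ j)) hg0
      have hc := hcomm _ _ _ _ hf0 hg0
      have hag := hcomm _ _ _ _ hf.2 hg1
      have t1 := (hcomm _ _ _ _ hf.2 (hcomm _ _ _ _ hf0 hg1)).mono hF
        (i := i + j + 1) (by omega)
      have t2 := (hcomm _ _ _ _ hf0 hg.2).mono hF (i := i + j + 1) (by omega)
      have t3 := (hcomm _ _ _ _ hg.2 hc).mono hF (i := i + j + 1) (by omega)
      have t4 := (hcomm _ _ _ _ hc hag).mono hF (i := i + j + 1) (by omega)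
      have t5 := hag.mono hF (i := i + j + 1) (by omega)
      convert hmul _ _ _ (hmul _ _ _ (hmul _ _ _ (hmul _ _ _ t1 t2) t3) t4) t5 using 2
      simp only [commutatorElement_def]
      group

lemma mul (hF : IsCommFiltration F) (hf : IsPolySeq F d j f) (hg : IsPolySeq F d j g) :
    IsPolySeq F d j fun n => f n * g n :=
  (mul_inv_commutator hF d).1 _ _ _ hf hg

lemma inv (hF : IsCommFiltration F) (hf : IsPolySeq F d j f) :
    IsPolySeq F d j fun n => (f n)⁻¹ :=
  (mul_inv_commutator hF d).2.1 _ _ hf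

lemma pow_choose (hF : IsCommFiltration F) {k : ℕ} {x : G} (hx : x ∈ F (j + k)) :
    IsPolySeq F d j fun n => x ^ n.choose k := by
  have hmem : ∀ n : ℕ, x ^ n.choose k ∈ F j := fun n =>
    pow_mem (hF.anti (Nat.le_add_right j k) hx) _
  induction d generalizing j k with
  | zero => exact hmem
  | succ d ih =>
    refine ⟨hmem, ?_⟩
    cases k with
    | zero => simpa using one
    | succ k =>
      have hx' : x ∈ F (j + 1 + k) := by rwa [add_assoc, add_comm 1 k]
      convert ih hx' fun n => pow_mem (hF.anti (Nat.le_add_right _ k) hx') _ using 2 with n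
      beta_reduce
      rw [Nat.choose_succ_succ', pow_add, mul_inv_cancel_right]

lemma mem_of_forall_lt {k : ℕ} (hk : k ≤ d) (hf : IsPolySeq F d j f) (h : ∀ n < k, f n = 1) :
    f k ∈ F (j + k) := by
  induction k generalizing d j f with
  | zero => exact hf.mem 0
  | succ k ih =>
    obtain ⟨d, rfl⟩ : ∃ d', d = d' + 1 := ⟨d - 1, by omega⟩
    have := ih (Nat.le_of_succ_le_succ hk) hf.2 fun n hn => by
      simp [h n (by omega), h (n + 1) (by omega)]
    simpa [h k (Nat.lt_succ_self k), add_assoc, add_comm 1 k] using this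

/-- The value at a prime `p` of a polynomial sequence `f` with `f 0 = 1`. Removing successively the
factors `g ^ n.choose k` with `k < p` (the Taylor expansion of `f`) changes the value at `p` only
by `f 1 ^ p` and by `p`-th powers of elements of `F 2`. -/
theorem apply_prime (hF : IsCommFiltration F) {p : ℕ} (hp : p.Prime) (hf : IsPolySeq F p 0 f)
    (h0 : f 0 = 1) (X : Subgroup G) [X.Normal] (hX2 : ∀ g ∈ F 2, g ^ p ∈ X) (hXp : F p ≤ X) :
    (f p : G ⧸ X) = (f 1 : G ⧸ X) ^ p := by
  have key : ∀ k, 1 ≤ k → k < p → ∃ g : ℕ → G, IsPolySeq F p 0 g ∧ (∀ n ≤ k, g n = 1) ∧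
      (g p : G ⧸ X) = ((f 1 : G ⧸ X) ^ p)⁻¹ * (f p : G ⧸ X) := by
    intro k hk
    induction k, hk using Nat.le_induction with
    | base =>
      intro _
      have h1 : f 1 ∈ F (0 + 1) := hf.mem_of_forall_lt hp.one_lt.le fun n hn => by
        rwa [Nat.lt_one_iff.mp hn]
      refine ⟨fun n => (f 1 ^ n.choose 1)⁻¹ * f n, ((pow_choose hF h1).inv hF).mul hF hf, ?_, ?_⟩
      · intro n hn
        interval_cases n <;> simp [h0]
      · simp
    | succ k hk ih =>
      intro hkp
      obtain ⟨g, hg, hg1, hgp⟩ := ih (by omega)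
      have hmem : g (k + 1) ∈ F (0 + (k + 1)) :=
        hg.mem_of_forall_lt hkp.le fun n hn => hg1 n (by omega)
      refine ⟨fun n => (g (k + 1) ^ n.choose (k + 1))⁻¹ * g n,
        ((pow_choose hF hmem).inv hF).mul hF hg, ?_, ?_⟩
      · intro n hn
        rcases hn.lt_or_eq with hn | rfl
        · simp [Nat.choose_eq_zero_of_lt hn, hg1 n (by omega)]
        · simp
      · obtain ⟨c, hc⟩ := hp.dvd_choose_self (Nat.succ_ne_zero k) hkp
        have : g (k + 1) ^ p.choose (k + 1) ∈ X := by
          rw [hc, pow_mul]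
          exact pow_mem (hX2 _ (hF.anti (by omega) hmem)) _
        rw [← hgp, QuotientGroup.mk_mul, (QuotientGroup.eq_one_iff _).mpr (inv_mem this), one_mul]
  obtain ⟨g, hg, hg1, hgp⟩ := key (p - 1) (by have := hp.two_le; omega)
    (by have := hp.two_le; omega)
  have hmem : g p ∈ F (0 + p) :=
    hg.mem_of_forall_lt le_rfl fun n hn => hg1 n (by omega)
  rw [zero_add] at hmem
  rw [(QuotientGroup.eq_one_iff _).mpr (hXp hmem)] at hgp
  exact (inv_mul_eq_one.mp hgp.symm).symm

end IsPolySeq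

end PolynomialSequences

/-! ### Iterated commutators and Hall's formulas -/

section IteratedCommutators

variable {G : Type*} [Group G]

/-- Three subgroups lemma, modulo a normal subgroup `X`. -/
lemma commutator_commutator_le_of_rotate {A B C X : Subgroup G} [X.Normal]
    (h1 : ⁅⁅B, C⁆, A⁆ ≤ X) (h2 : ⁅⁅C, A⁆, B⁆ ≤ X) : ⁅⁅A, B⁆, C⁆ ≤ X := by
  have key : ∀ H : Subgroup G, H ≤ X ↔ H.map (QuotientGroup.mk' X) = ⊥ := fun H => by
    rw [Subgroup.map_eq_bot_iff, QuotientGroup.ker_mk']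
  rw [key] at *
  simp only [Subgroup.map_commutator] at *
  exact Subgroup.commutator_commutator_eq_bot_of_rotate h1 h2

/-- It suffices to test `⁅A, K⁆ ≤ X` on generators of `A`, for `X` normal. -/
lemma commutator_closure_le {S : Set G} {K X : Subgroup G} [X.Normal]
    (h : ∀ s ∈ S, ∀ k ∈ K, ⁅s, k⁆ ∈ X) : ⁅Subgroup.closure S, K⁆ ≤ X := by
  rw [Subgroup.commutator_le]
  intro a ha k hk
  have hc : ∀ x : G, ⁅x, k⁆ ∈ X ↔ Commute (x : G ⧸ X) (k : G ⧸ X) := fun x => by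
    rw [← QuotientGroup.eq_one_iff, ← commutatorElement_eq_one_iff_commute]
    rfl
  rw [hc]
  induction ha using Subgroup.closure_induction with
  | mem x hx => exact (hc x).mp (h x hx k hk)
  | one => exact Commute.one_left _
  | mul x y _ _ hx hy => exact hx.mul_left hy
  | inv x _ hx => exact hx.inv_left

lemma commutator_sup_le {X A B K : Subgroup G} [X.Normal] [A.Normal] [K.Normal]
    (h : B ≤ X ⊔ A) : ⁅B, K⁆ ≤ X ⊔ ⁅A, K⁆ := by
  rw [Subgroup.commutator_le]
  intro b hb k hk
  obtain ⟨x, hx, a, ha, rfl⟩ := Subgroup.mem_sup_of_normal_left.mp (h hb)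
  rw [commutatorElement_mul_left_eq_conj_mul]
  exact mul_mem ((inferInstance : (X ⊔ ⁅A, K⁆).Normal).conj_mem _
    (Subgroup.mem_sup_right (Subgroup.commutator_mem_commutator ha hk)) _)
    (Subgroup.mem_sup_left (Subgroup.commutator_le_left X K
      (Subgroup.commutator_mem_commutator hx hk)))

/-- The iterated commutator subgroup `[A, K, …, K]` with `j` entries `K`. -/
def iterComm (A K : Subgroup G) : ℕ → Subgroup G
  | 0 => A
  | j + 1 => ⁅iterComm A K j, K⁆

variable {A K : Subgroup G}

instance iterComm_normal [A.Normal] [K.Normal] (j : ℕ) : (iterComm A K j).Normal := by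
  induction j with
  | zero => assumption
  | succ j ih => exact Subgroup.commutator_normal _ _

lemma iterComm_antitone [A.Normal] [K.Normal] : Antitone (iterComm A K) :=
  antitone_nat_of_succ_le fun _ => Subgroup.commutator_le_left _ _

lemma iterComm_mono_left {B : Subgroup G} (h : A ≤ B) (j : ℕ) :
    iterComm A K j ≤ iterComm B K j := by
  induction j with
  | zero => exact h
  | succ j ih => exact Subgroup.commutator_mono ih le_rfl

lemma iterComm_iterComm (i j : ℕ) : iterComm (iterComm A K i) K j = iterComm A K (i + j) := by
  induction j with
  | zero => rfl
  | succ j ih => rw [iterComm, ih]; rfl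

lemma iterComm_top_top (j : ℕ) :
    iterComm (⊤ : Subgroup G) ⊤ j = (⊤ : Subgroup G).lowerCentralSeries j := by
  induction j with
  | zero => rfl
  | succ j ih => rw [iterComm, ih]; rfl

lemma commutator_iterComm_self_le [A.Normal] [K.Normal] (i j : ℕ) :
    ⁅iterComm A K i, iterComm K K j⁆ ≤ iterComm A K (i + j + 1) := by
  induction j generalizing i with
  | zero => exact le_rfl
  | succ j ih =>
    rw [Subgroup.commutator_comm]
    apply commutator_commutator_le_of_rotate
    · rw [Subgroup.commutator_comm K]
      exact (ih (i + 1)).trans_eq (congrArg _ (by ring))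
    · exact Subgroup.commutator_mono (ih i) le_rfl

lemma commutator_iterComm_le [A.Normal] [K.Normal] (hAK : A ≤ K) (i j : ℕ) :
    ⁅iterComm A K i, iterComm A K j⁆ ≤ iterComm A K (i + j + 1) :=
  (Subgroup.commutator_mono le_rfl (iterComm_mono_left hAK j)).trans
    (commutator_iterComm_self_le i j)

/-- If `A ≤ X [A, K]` with `G` nilpotent and `X` normal, then `A ≤ X`. -/
lemma le_of_le_sup_commutator [Group.IsNilpotent G] {X : Subgroup G} [X.Normal] [A.Normal]
    [K.Normal] (h : A ≤ X ⊔ ⁅A, K⁆) : A ≤ X := by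
  have key : ∀ j, A ≤ X ⊔ iterComm A K j := by
    intro j
    induction j with
    | zero => exact le_sup_right
    | succ j ih => exact h.trans (sup_le le_sup_left (commutator_sup_le ih))
  obtain ⟨n, hn⟩ := Subgroup.nilpotent_iff_lowerCentralSeries.mp ‹Group.IsNilpotent G›
  have hbot : ∀ j, iterComm A K j ≤ (⊤ : Subgroup G).lowerCentralSeries j := by
    intro j
    induction j with
    | zero => exact le_top
    | succ j ih => exact Subgroup.commutator_mono ih le_top
  have := key n
  rwa [le_bot_iff.mp ((hbot n).trans_eq hn), sup_bot_eq] at this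

variable [A.Normal] [K.Normal] {X : Subgroup G} [X.Normal] {p : ℕ}

/-- Hall's formula for the `p`-th power of a product. -/
theorem mul_pow_prime_eq (hp : p.Prime) (hAK : A ≤ K)
    (hX1 : ∀ g ∈ iterComm A K 1, g ^ p ∈ X) (hXp : iterComm A K (p - 1) ≤ X)
    {x y : G} (hx : x ∈ A) (hy : y ∈ A) : ((x * y : G) : G ⧸ X) ^ p = x ^ p * y ^ p := by
  have hF : IsCommFiltration fun j => iterComm A K (j - 1) :=
    ⟨fun i j hij => iterComm_antitone (Nat.sub_le_sub_right hij 1), fun i j =>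
      (commutator_iterComm_le hAK _ _).trans (iterComm_antitone (by omega))⟩
  have hmul := (IsPolySeq.pow_choose (d := p) (j := 0) (k := 1) hF hx).mul hF
    (IsPolySeq.pow_choose (k := 1) hF hy)
  simpa using (hmul.apply_prime hF hp (by simp) X hX1 hXp).symm

/-- Hall's formula for the commutator with a `p`-th power. -/
theorem commutator_pow_prime_eq (hp : p.Prime) (hAK : A ≤ K)
    (hX2 : ∀ g ∈ iterComm A K 2, g ^ p ∈ X) (hXp : iterComm A K p ≤ X)
    {x y : G} (hx : x ∈ K) (hy : y ∈ K) (hxy : x ∈ A ∨ y ∈ A) :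
    ((⁅x ^ p, y⁆ : G) : G ⧸ X) = ((⁅x, y⁆ : G) : G ⧸ X) ^ p := by
  have hF : IsCommFiltration (iterComm A K) :=
    ⟨iterComm_antitone, fun i j =>
      (commutator_iterComm_le hAK _ _).trans (iterComm_antitone (by omega))⟩
  have hconj : ∀ (d j : ℕ) (c : G), c ∈ iterComm A K j →
      IsPolySeq (iterComm A K) d j fun n => x ^ n * c * (x ^ n)⁻¹ := by
    intro d
    induction d with
    | zero => exact fun j c hc n => (iterComm_normal j).conj_mem _ hc _
    | succ d ih =>
      refine fun j c hc => ⟨fun n => (iterComm_normal j).conj_mem _ hc _, ?_⟩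
      have hxc : ⁅x, c⁆ ∈ iterComm A K (j + 1) := by
        rw [iterComm, Subgroup.commutator_comm]
        exact Subgroup.commutator_mem_commutator hx hc
      convert ih (j + 1) ⁅x, c⁆ hxc using 2 with n
      simp only [commutatorElement_def, pow_succ]
      group
  have hmem : ∀ g ∈ K, g ∈ A ∨ y ∈ A → ⁅g, y⁆ ∈ iterComm A K 1 := by
    rintro g hg (h | h)
    · exact Subgroup.commutator_mem_commutator h hy
    · rw [iterComm, Subgroup.commutator_comm]
      exact Subgroup.commutator_mem_commutator hg h
  have hpoly : IsPolySeq (iterComm A K) p 0 fun n => ⁅x ^ n, y⁆ := by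
    refine IsPolySeq.of_succ ⟨fun n => iterComm_antitone (Nat.zero_le 1)
      (hmem _ (pow_mem hx n) (hxy.imp_left fun h => pow_mem h n)), ?_⟩
    convert hconj p 1 _ (hmem x hx hxy) using 2 with n
    simp only [commutatorElement_def, pow_succ]
    group
  simpa using hpoly.apply_prime hF hp (by simp) X hX2 hXp

end IteratedCommutators

/-! ### Maximal subgroups of `p`-groups -/

section Frattini

variable {G : Type*} [Group G]

lemma mem_frattini_iff {g : G} : g ∈ frattini G ↔ ∀ M : Subgroup G, IsCoatom M → g ∈ M := by
  simp [frattini, Order.radical, Subgroup.mem_iInf]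

lemma closure_mk_pair_eq_top (N : Subgroup G) [N.Normal] {x y : G}
    (h : Subgroup.closure {x, y} = ⊤) : Subgroup.closure {(x : G ⧸ N), (y : G ⧸ N)} = ⊤ := by
  have h1 := congrArg (Subgroup.map (QuotientGroup.mk' N)) h
  rwa [MonoidHom.map_closure, Set.image_pair,
    Subgroup.map_top_of_surjective _ (QuotientGroup.mk'_surjective N)] at h1

lemma Commute.exists_zpow_mul_zpow {a b : G} (hc : Commute a b)
    (hab : Subgroup.closure {a, b} = ⊤) (w : G) : ∃ i j : ℤ, w = a ^ i * b ^ j := by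
  have hw : w ∈ Subgroup.closure {a, b} := hab ▸ Subgroup.mem_top w
  induction hw using Subgroup.closure_induction with
  | mem x hx =>
    rcases hx with rfl | rfl
    · exact ⟨1, 0, by simp⟩
    · exact ⟨0, 1, by simp⟩
  | one => exact ⟨0, 0, by simp⟩
  | mul x y _ _ hx hy =>
    obtain ⟨i, j, rfl⟩ := hx
    obtain ⟨k, l, rfl⟩ := hy
    refine ⟨i + k, j + l, ?_⟩
    rw [zpow_add, zpow_add, mul_assoc, ← mul_assoc (b ^ j), ← (hc.zpow_zpow k j).eq]
    simp only [mul_assoc]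
  | inv x _ hx =>
    obtain ⟨i, j, rfl⟩ := hx
    refine ⟨-i, -j, ?_⟩
    rw [(hc.zpow_zpow i j).eq, mul_inv_rev, zpow_neg, zpow_neg]

lemma exists_zpow_of_isCoatom {M : Subgroup G}
    [M.Normal] (hM : IsCoatom M) {g : G} (hg : g ∉ M) (h : G) :
    ∃ k : ℤ, (h : G ⧸ M) = (g : G ⧸ M) ^ k := by
  have htop : M ⊔ Subgroup.zpowers g = ⊤ := hM.2 _ <| lt_of_le_of_ne le_sup_left fun h =>
    hg (h ▸ Subgroup.mem_sup_right (Subgroup.mem_zpowers _))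
  obtain ⟨m, hm, _, ⟨k, rfl⟩, hmk⟩ := Subgroup.mem_sup_of_normal_left.mp
    (htop ▸ Subgroup.mem_top h : h ∈ M ⊔ Subgroup.zpowers g)
  refine ⟨k, ?_⟩
  rw [← hmk]
  simp [(QuotientGroup.eq_one_iff m).mpr hm]

variable [Finite G] {p : ℕ}

lemma IsPGroup.normal_of_isCoatom [Fact p.Prime] (hG : IsPGroup p G) {M : Subgroup G}
    (hM : IsCoatom M) : M.Normal := by
  have := hG.isNilpotent
  have h := ((Group.isNilpotent_of_finite_tfae (G := G)).out 0 2 :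
    Group.IsNilpotent G ↔ ∀ H : Subgroup G, IsCoatom H → H.Normal)
  exact h.mp this M hM

lemma IsPGroup.pow_mem_of_isCoatom [Fact p.Prime] (hG : IsPGroup p G) {M : Subgroup G}
    (hM : IsCoatom M) (g : G) : g ^ p ∈ M := by
  have hn := hG.normal_of_isCoatom hM
  by_contra hgp
  have hg : g ∉ M := fun h => hgp (pow_mem h p)
  -- otherwise `g` is a power of `g ^ p` modulo `M`, and its order there is prime to `p`
  obtain ⟨k, hk⟩ := exists_zpow_of_isCoatom hM hgp g
  have hq : (g : G ⧸ M) ^ (1 - p * k : ℤ) = 1 := by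
    have : (g : G ⧸ M) ^ (p * k : ℤ) = g := by
      conv_rhs => rw [hk]
      simp [zpow_mul]
    rw [zpow_sub, this]; simp
  have h1 : (orderOf (g : G ⧸ M) : ℤ) ∣ 1 - p * k := orderOf_dvd_iff_zpow_eq_one.mpr hq
  have h2 : p ∣ orderOf (g : G ⧸ M) :=
    (hG.to_quotient M).dvd_orderOf fun h => hg ((QuotientGroup.eq_one_iff g).mp h)
  have h3 : (p : ℤ) ∣ 1 := by
    have := ((Int.natCast_dvd_natCast.mpr h2).trans h1).add (Dvd.intro k rfl : (p : ℤ) ∣ p * k)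
    simpa using this
  exact (Fact.out : p.Prime).one_lt.ne' (by exact_mod_cast Int.eq_one_of_dvd_one (by positivity) h3)

lemma IsPGroup.commutator_mem_of_isCoatom [Fact p.Prime] (hG : IsPGroup p G) {M : Subgroup G}
    (hM : IsCoatom M) (g h : G) : ⁅g, h⁆ ∈ M := by
  have hn := hG.normal_of_isCoatom hM
  by_cases hg : g ∈ M
  · exact Subgroup.commutator_le_left M ⊤
      (Subgroup.commutator_mem_commutator hg (Subgroup.mem_top h))
  · obtain ⟨k, hk⟩ := exists_zpow_of_isCoatom hM hg h
    have h1 : Commute (g : G ⧸ M) (h : G ⧸ M) := hk ▸ (Commute.refl _).zpow_right k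
    exact (QuotientGroup.eq_one_iff _).mp (commutatorElement_eq_one_iff_commute.mpr h1)

lemma IsPGroup.pow_mem_frattini [Fact p.Prime] (hG : IsPGroup p G) (g : G) :
    g ^ p ∈ frattini G :=
  mem_frattini_iff.mpr fun _ hM => hG.pow_mem_of_isCoatom hM g

lemma IsPGroup.mk_frattini_comm [Fact p.Prime] (hG : IsPGroup p G) (g h : G ⧸ frattini G) :
    g * h = h * g := by
  induction g using QuotientGroup.induction_on with | H g
  induction h using QuotientGroup.induction_on with | H h
  exact commutatorElement_eq_one_iff_mul_comm.mp ((QuotientGroup.eq_one_iff _).mpr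
    (mem_frattini_iff.mpr fun _ hM => hG.commutator_mem_of_isCoatom hM g h))

lemma IsPGroup.exists_mk_frattini_eq [Fact p.Prime] (hG : IsPGroup p G) {a b : G}
    (hab : Subgroup.closure {a, b} = ⊤) (w : G) :
    ∃ i j : ℤ, (w : G ⧸ frattini G) = (a : G ⧸ frattini G) ^ i * (b : G ⧸ frattini G) ^ j :=
  Commute.exists_zpow_mul_zpow (hG.mk_frattini_comm _ _) (closure_mk_pair_eq_top _ hab) w

lemma IsPGroup.closure_pair_eq_top_of_not_dvd [Fact p.Prime] (hG : IsPGroup p G) {a b w : G}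
    (hab : Subgroup.closure {a, b} = ⊤) {i j : ℤ}
    (hw : (w : G ⧸ frattini G) = (a : G ⧸ frattini G) ^ i * (b : G ⧸ frattini G) ^ j)
    (hi : ¬ (p : ℤ) ∣ i) : Subgroup.closure {w, b} = ⊤ := by
  apply frattini_nongenerating
  rw [← top_le_iff, ← hab, Subgroup.closure_le]
  have hb : b ∈ Subgroup.closure {w, b} := Subgroup.subset_closure (by simp)
  have hww : w ∈ Subgroup.closure {w, b} := Subgroup.subset_closure (by simp)
  rw [Set.insert_subset_iff, Set.singleton_subset_iff]
  constructor
  · obtain ⟨u, v, huv⟩ : IsCoprime i p :=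
      ((Nat.prime_iff_prime_int.mp Fact.out).coprime_iff_not_dvd.mpr hi).symm
    set y := (w * b ^ (-j)) ^ u
    have hy : y ∈ Subgroup.closure {w, b} := zpow_mem (mul_mem hww (zpow_mem hb _)) _
    have hap : (a : G ⧸ frattini G) ^ p = 1 :=
      (QuotientGroup.eq_one_iff _).mpr (hG.pow_mem_frattini a)
    have : (y : G ⧸ frattini G) = a := by
      have hy1 : (y : G ⧸ frattini G) =
        ((w : G ⧸ frattini G) * (b : G ⧸ frattini G) ^ (-j)) ^ u := rfl
      rw [hy1, hw, zpow_neg, mul_inv_cancel_right]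
      calc _ = (a : G ⧸ frattini G) ^ (u * i + v * p) := by
            rw [zpow_add, mul_comm v, zpow_mul _ (p : ℤ), zpow_natCast, hap, one_zpow, mul_one,
              mul_comm u, zpow_mul]
        _ = a := by rw [huv, zpow_one]
    rw [← mul_inv_cancel_left y a]
    exact mul_mem (Subgroup.mem_sup_left hy)
      (Subgroup.mem_sup_right (QuotientGroup.eq.mp this))
  · exact Subgroup.mem_sup_left hb

/-- In a `2`-generator `p`-group, every element outside the Frattini subgroup belongs to a
generating pair. -/
lemma IsPGroup.exists_closure_pair_eq_top [Fact p.Prime] (hG : IsPGroup p G)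
    (h2 : ∃ a b : G, Subgroup.closure {a, b} = ⊤) {w : G} (hw : w ∉ frattini G) :
    ∃ z : G, Subgroup.closure {w, z} = ⊤ := by
  obtain ⟨a, b, hab⟩ := h2
  obtain ⟨i, j, hij⟩ := hG.exists_mk_frattini_eq hab w
  by_cases hi : (p : ℤ) ∣ i
  · by_cases hj : (p : ℤ) ∣ j
    · obtain ⟨k, rfl⟩ := hi
      obtain ⟨l, rfl⟩ := hj
      have hp1 : ∀ x : G, (x : G ⧸ frattini G) ^ p = 1 := fun x =>
        (QuotientGroup.eq_one_iff _).mpr (hG.pow_mem_frattini x)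
      refine absurd ((QuotientGroup.eq_one_iff w).mp ?_) hw
      simp [hij, zpow_mul, hp1]
    · rw [hG.mk_frattini_comm] at hij
      exact ⟨a, hG.closure_pair_eq_top_of_not_dvd (by rwa [Set.pair_comm]) hij hj⟩
  · exact ⟨b, hG.closure_pair_eq_top_of_not_dvd hab hij hi⟩

end Frattini

/-! ### Subgroups generated by `p`-th powers -/

section PowGen

variable {G : Type*} [Group G] {p : ℕ}

/-- The subgroup `A ^ p` generated by the `p`-th powers of the elements of a subgroup `A`. -/
def powGen (p : ℕ) (A : Subgroup G) : Subgroup G :=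
  Subgroup.closure ((fun g : G => g ^ p) '' A)

lemma pow_mem_powGen {A : Subgroup G} {x : G} (hx : x ∈ A) : x ^ p ∈ powGen p A :=
  Subgroup.subset_closure ⟨x, hx, rfl⟩

lemma powGen_le_iff {A X : Subgroup G} : powGen p A ≤ X ↔ ∀ x ∈ A, x ^ p ∈ X := by
  simp [powGen, Subgroup.closure_le, Set.subset_def]

lemma commutator_powGen_le {A K X : Subgroup G} [X.Normal]
    (h : ∀ x ∈ A, ∀ k ∈ K, ⁅x ^ p, k⁆ ∈ X) : ⁅powGen p A, K⁆ ≤ X := by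
  refine commutator_closure_le ?_
  rintro _ ⟨x, hx, rfl⟩ k hk
  exact h x hx k hk

lemma powGen_mono {A B : Subgroup G} (h : A ≤ B) : powGen p A ≤ powGen p B :=
  powGen_le_iff.mpr fun _ hx => pow_mem_powGen (h hx)

lemma powGen_le (A : Subgroup G) : powGen p A ≤ A :=
  powGen_le_iff.mpr fun _ hx => pow_mem hx p

lemma powGen_top : powGen p (⊤ : Subgroup G) = powerSubgroup G p := by
  simp [powGen, powerSubgroup]

lemma closure_normal_of_conj {S : Set G} (h : ∀ s ∈ S, ∀ g : G, g * s * g⁻¹ ∈ S) :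
    (Subgroup.closure S).Normal := by
  refine ⟨fun n hn g => ?_⟩
  induction hn using Subgroup.closure_induction with
  | mem x hx => exact Subgroup.subset_closure (h x hx g)
  | one => simp
  | mul x y _ _ hx hy => simpa using mul_mem hx hy
  | inv x _ hx => simpa [mul_assoc] using inv_mem hx

instance powGen_normal (A : Subgroup G) [A.Normal] : (powGen p A).Normal := by
  apply closure_normal_of_conj
  rintro _ ⟨x, hx, rfl⟩ g
  exact ⟨g * x * g⁻¹, ‹A.Normal›.conj_mem x hx g, conj_pow⟩

instance powerSubgroup_normal (n : ℕ) : (powerSubgroup G n).Normal := by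
  apply closure_normal_of_conj
  rintro _ ⟨x, rfl⟩ g
  exact ⟨g * x * g⁻¹, conj_pow⟩

lemma pow_mem_powerSubgroup (x : G) (n : ℕ) : x ^ n ∈ powerSubgroup G n :=
  Subgroup.subset_closure ⟨x, rfl⟩

lemma mk_eq_mk_of_le {X Y : Subgroup G} (h : X ≤ Y) {a b : G}
    (hab : (a : G ⧸ X) = (b : G ⧸ X)) : (a : G ⧸ Y) = (b : G ⧸ Y) :=
  QuotientGroup.eq.mpr (h (QuotientGroup.eq.mp hab))

/-- If taking `p`-th powers is multiplicative on `A` modulo `X`, then `A ^ p ≤ X` can be tested on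
generators of `A`. -/
lemma powGen_closure_le {S : Set G} {X : Subgroup G} [X.Normal]
    (hmul : ∀ x ∈ Subgroup.closure S, ∀ y ∈ Subgroup.closure S,
      ((x * y : G) : G ⧸ X) ^ p = x ^ p * y ^ p)
    (hS : ∀ s ∈ S, s ^ p ∈ X) : powGen p (Subgroup.closure S) ≤ X := by
  rw [powGen_le_iff]
  intro x hx
  rw [← QuotientGroup.eq_one_iff, QuotientGroup.mk_pow]
  induction hx using Subgroup.closure_induction with
  | mem x hx => exact (QuotientGroup.eq_one_iff _).mpr (hS x hx)
  | one => simp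
  | mul x y hx hy ihx ihy => rw [hmul x hx y hy, ihx, ihy, one_mul]
  | inv x _ hx => simp [hx]

/-- A nontrivial finite `p`-group is not generated by its `p`-th powers. -/
lemma eq_bot_of_le_powGen [Finite G] [Fact p.Prime] (hG : IsPGroup p G) {A : Subgroup G}
    (hA : A ≤ powGen p A) : A = ⊥ := by
  rcases eq_top_or_exists_le_coatom (⊥ : Subgroup A) with h | ⟨M, hM, -⟩
  · have : Subsingleton A := by
      rw [← Subgroup.subsingleton_iff]
      exact subsingleton_of_bot_eq_top h
    exact Subgroup.eq_bot_of_subsingleton A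
  · refine absurd (top_le_iff.mp fun x _ => ?_) hM.1
    have hle : powGen p A ≤ M.map A.subtype := powGen_le_iff.mpr fun y hy =>
      ⟨⟨y, hy⟩ ^ p, (hG.to_subgroup A).pow_mem_of_isCoatom hM ⟨y, hy⟩, rfl⟩
    obtain ⟨y, hy, hyx⟩ := hle (hA x.2)
    rwa [← Subtype.ext hyx]

/-- The iterated subgroups of `p`-th powers of `A`. -/
def powChain (p : ℕ) (A : Subgroup G) : ℕ → Subgroup G
  | 0 => A
  | j + 1 => powGen p (powChain p A j)

variable {A : Subgroup G}

instance powChain_normal [A.Normal] (j : ℕ) : (powChain p A j).Normal := by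
  induction j with
  | zero => assumption
  | succ j ih => exact powGen_normal _

lemma powChain_antitone : Antitone (powChain p A) :=
  antitone_nat_of_succ_le fun _ => powGen_le _

lemma pow_mem_powChain {j k : ℕ} {x : G} (hx : x ∈ powChain p A j) :
    x ^ p ^ k ∈ powChain p A (j + k) := by
  induction k with
  | zero => simpa
  | succ k ih =>
    rw [pow_succ, pow_mul]
    exact pow_mem_powGen ih

/-- Taking `p`-th powers induces homomorphisms between consecutive factors of the series of
iterated `p`-th power subgroups of `A`. -/
def IsPowMulChain (p : ℕ) (A : Subgroup G) [A.Normal] : Prop :=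
  ∀ j, ∀ x ∈ powChain p A j, ∀ y ∈ powChain p A j,
    ((x * y : G) : G ⧸ powChain p A (j + 2)) ^ p = x ^ p * y ^ p

lemma IsPowMulChain.mul_pow_pow [A.Normal] (h : IsPowMulChain p A) {x y : G} (hx : x ∈ A)
    (hy : y ∈ A) (k : ℕ) :
    ((x * y : G) : G ⧸ powChain p A (k + 1)) ^ p ^ k = x ^ p ^ k * y ^ p ^ k := by
  induction k with
  | zero => simp
  | succ k ih =>
    have hxk : x ^ p ^ k ∈ powChain p A k := by
      simpa using pow_mem_powChain (j := 0) (k := k) (p := p) hx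
    have hyk : y ^ p ^ k ∈ powChain p A k := by
      simpa using pow_mem_powChain (j := 0) (k := k) (p := p) hy
    obtain ⟨z, hz, hxy⟩ : ∃ z ∈ powChain p A (k + 1),
        (x * y) ^ p ^ k = x ^ p ^ k * y ^ p ^ k * z := by
      refine ⟨(x ^ p ^ k * y ^ p ^ k)⁻¹ * (x * y) ^ p ^ k, ?_, by group⟩
      rw [← QuotientGroup.eq]
      simpa using ih.symm
    have hzk := powChain_antitone (Nat.le_succ k) hz
    have hzp : (z : G ⧸ powChain p A (k + 2)) ^ p = 1 :=
      (QuotientGroup.eq_one_iff _).mpr (pow_mem_powGen hz)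
    calc ((x * y : G) : G ⧸ powChain p A (k + 2)) ^ p ^ (k + 1)
        = ((x ^ p ^ k * y ^ p ^ k * z : G) : G ⧸ powChain p A (k + 2)) ^ p := by
          rw [← hxy, pow_succ, pow_mul, QuotientGroup.mk_pow]
      _ = x ^ p ^ (k + 1) * y ^ p ^ (k + 1) := by
          rw [h k _ (mul_mem hxk hyk) _ hzk, hzp, mul_one, h k _ hxk _ hyk]
          simp [pow_succ, pow_mul]

/-- For `A = G ^ (p ^ s)`, the `k`-th iterated `p`-th power subgroup of `A` equals
`G ^ (p ^ (s + k))` up to the next term. -/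
lemma IsPowMulChain.le_powerSubgroup_sup {s : ℕ} (h : IsPowMulChain p (powerSubgroup G (p ^ s)))
    (k : ℕ) : powChain p (powerSubgroup G (p ^ s)) k ≤
      powerSubgroup G (p ^ (s + k)) ⊔ powChain p (powerSubgroup G (p ^ s)) (k + 1) := by
  set A := powerSubgroup G (p ^ s)
  induction k with
  | zero => exact le_sup_left
  | succ k ih =>
    set S : Set G := Set.range (fun g : G => g ^ p ^ (s + k)) ∪ powChain p A (k + 1)
    have hS : Subgroup.closure S = powChain p A k := by
      refine le_antisymm ?_ (ih.trans (sup_le (Subgroup.closure_mono Set.subset_union_left) ?_))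
      · rw [Subgroup.closure_le]
        rintro _ (⟨g, rfl⟩ | hg)
        · have := pow_mem_powChain (p := p) (A := A) (j := 0) (k := k) (pow_mem_powerSubgroup g _)
          simpa [pow_add, pow_mul] using this
        · exact powChain_antitone (Nat.le_succ k) hg
      · exact fun g hg => Subgroup.subset_closure (Or.inr hg)
    have hle : powChain p A (k + 2) ≤
      powerSubgroup G (p ^ (s + (k + 1))) ⊔ powChain p A (k + 2) := le_sup_right
    change powGen p (powChain p A k) ≤ _
    rw [← hS]
    refine powGen_closure_le (fun x hx y hy => ?_) ?_
    · rw [hS] at hx hy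
      exact mk_eq_mk_of_le (a := (x * y) ^ p) (b := x ^ p * y ^ p) hle (h k x hx y hy)
    · rintro _ (⟨g, rfl⟩ | hg)
      · beta_reduce
        rw [← pow_mul, ← pow_succ]
        exact Subgroup.mem_sup_left (pow_mem_powerSubgroup g _)
      · exact hle (pow_mem_powGen hg)

variable [Finite G] [Fact p.Prime]

lemma IsPowMulChain.powChain_eq_bot (hG : IsPGroup p G) {s : ℕ}
    (h : IsPowMulChain p (powerSubgroup G (p ^ s))) {k : ℕ} (hk : ∀ g : G, g ^ p ^ (s + k) = 1) :
    powChain p (powerSubgroup G (p ^ s)) k = ⊥ := by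
  refine eq_bot_of_le_powGen hG ((h.le_powerSubgroup_sup k).trans (sup_le ?_ le_rfl))
  rw [powerSubgroup, Subgroup.closure_le]
  rintro _ ⟨g, rfl⟩
  simp [hk g]

lemma IsPowMulChain.mul_pow_eq (hG : IsPGroup p G) {s : ℕ}
    (h : IsPowMulChain p (powerSubgroup G (p ^ s))) {k : ℕ}
    (hk : ∀ g : G, g ^ p ^ (s + (k + 1)) = 1) {x y : G} (hx : x ∈ powerSubgroup G (p ^ s))
    (hy : y ∈ powerSubgroup G (p ^ s)) : (x * y) ^ p ^ k = x ^ p ^ k * y ^ p ^ k := by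
  have := (QuotientGroup.eq (a := (x * y) ^ p ^ k) (b := x ^ p ^ k * y ^ p ^ k)).mp
    (h.mul_pow_pow hx hy k)
  rw [h.powChain_eq_bot hG hk, Subgroup.mem_bot] at this
  exact inv_mul_eq_one.mp this

end PowGen

/-! ### Power structure of potent `p`-groups -/

section Potent

variable {G : Type*} [Group G] {p : ℕ}

local notation "γ" => Subgroup.lowerCentralSeries (⊤ : Subgroup G)

lemma iterComm_lowerCentralSeries (k j : ℕ) : iterComm (γ k) ⊤ j = γ (k + j) := by
  rw [← iterComm_top_top, iterComm_iterComm, iterComm_top_top]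

lemma commutator_pow_lowerCentralSeries (hp : p.Prime) (k : ℕ) {X : Subgroup G} [X.Normal]
    (hX : powGen p (γ (k + 2)) ≤ X) (hXp : γ (k + p) ≤ X) {x : G} (hx : x ∈ γ k) (y : G) :
    ((⁅x ^ p, y⁆ : G) : G ⧸ X) = ((⁅x, y⁆ : G) : G ⧸ X) ^ p := by
  refine commutator_pow_prime_eq hp (A := γ k) (K := ⊤) le_top (fun g hg => ?_) ?_
    (Subgroup.mem_top x) (Subgroup.mem_top y) (Or.inl hx)
  · rw [iterComm_lowerCentralSeries] at hg
    exact hX (pow_mem_powGen hg)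
  · rwa [iterComm_lowerCentralSeries]

lemma commutator_powGen_le_sup (hp : p.Prime) (k : ℕ) :
    ⁅powGen p (γ k), ⊤⁆ ≤ powGen p (γ (k + 1)) ⊔ γ (k + p) := by
  refine commutator_powGen_le fun x hx y _ => ?_
  rw [← QuotientGroup.eq_one_iff, commutator_pow_lowerCentralSeries hp k _ le_sup_right hx,
    ← QuotientGroup.mk_pow, QuotientGroup.eq_one_iff]
  · exact Subgroup.mem_sup_left (pow_mem_powGen
      (Subgroup.commutator_mem_commutator hx (Subgroup.mem_top y)))
  · exact (powGen_mono (Subgroup.lowerCentralSeries_antitone ⊤ (Nat.le_succ _))).trans le_sup_left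

variable [Group.IsNilpotent G]

/-- The defining inclusion of potent groups propagates along the lower central series. -/
lemma lowerCentralSeries_le_powGen (hp : p.Prime) (hpot : γ (p - 2) ≤ powGen p ⊤) (k : ℕ) :
    γ (k + (p - 2)) ≤ powGen p (γ k) := by
  have := hp.two_le
  induction k with
  | zero => simpa using hpot
  | succ k ih =>
    apply le_of_le_sup_commutator (K := ⊤)
    have h1 : ⁅γ (k + 1 + (p - 2)), ⊤⁆ = γ (k + p) := by
      rw [← Subgroup.lowerCentralSeries_succ]
      congr 1
      omega
    have h2 : γ (k + 1 + (p - 2)) = ⁅γ (k + (p - 2)), ⊤⁆ := by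
      rw [← Subgroup.lowerCentralSeries_succ]
      congr 1
      omega
    rw [h1, h2]
    exact (Subgroup.commutator_mono ih le_rfl).trans (commutator_powGen_le_sup hp k)

lemma commutator_pow_eq_of_potent (hp : p.Prime) (hpot : γ (p - 2) ≤ powGen p ⊤) (k : ℕ) {x : G}
    (hx : x ∈ γ k) (y : G) : ((⁅x ^ p, y⁆ : G) : G ⧸ powGen p (γ (k + 2))) = ⁅x, y⁆ ^ p := by
  refine commutator_pow_lowerCentralSeries hp k le_rfl ?_ hx y
  convert lowerCentralSeries_le_powGen hp hpot (k + 2) using 2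
  have := hp.two_le
  omega

lemma mul_pow_eq_of_potent (hp : p.Prime) (hpot : γ (p - 2) ≤ powGen p ⊤) (k : ℕ) {x y : G}
    (hx : x ∈ γ k) (hy : y ∈ γ k) :
    ((x * y : G) : G ⧸ powGen p (γ (k + 1))) ^ p = x ^ p * y ^ p := by
  refine mul_pow_prime_eq hp (A := γ k) (K := ⊤) le_top (fun g hg => pow_mem_powGen ?_) ?_ hx hy
  · rwa [iterComm_lowerCentralSeries] at hg
  · rw [iterComm_lowerCentralSeries]
    convert lowerCentralSeries_le_powGen hp hpot (k + 1) using 2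
    have := hp.two_le
    omega

/-- In a potent `p`-group, `[γ_k(G) ^ p, G] = γ_{k+1}(G) ^ p`. -/
theorem commutator_powGen_lowerCentralSeries (hp : p.Prime) (hpot : γ (p - 2) ≤ powGen p ⊤)
    (k : ℕ) : ⁅powGen p (γ k), ⊤⁆ = powGen p (γ (k + 1)) := by
  have hle : ∀ k, ⁅powGen p (γ k), ⊤⁆ ≤ powGen p (γ (k + 1)) := fun k => by
    refine (commutator_powGen_le_sup hp k).trans (sup_le le_rfl (le_trans ?_
      (lowerCentralSeries_le_powGen hp hpot (k + 1))))
    have := hp.two_le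
    exact Subgroup.lowerCentralSeries_antitone ⊤ (by omega)
  have hge : ∀ k, powGen p (γ (k + 1)) ≤ ⁅powGen p (γ k), ⊤⁆ ⊔ powGen p (γ (k + 2)) := by
    intro k
    refine powGen_closure_le (S := {g | ∃ g₁ ∈ γ k, ∃ g₂ ∈ (⊤ : Subgroup G), ⁅g₁, g₂⁆ = g})
      (fun x hx y hy => ?_) ?_
    · exact mk_eq_mk_of_le (a := (x * y) ^ p) (b := x ^ p * y ^ p) le_sup_right
        (mul_pow_eq_of_potent hp hpot (k + 1) hx hy)
    · rintro _ ⟨x, hx, y, hy, rfl⟩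
      have h1 := mk_eq_mk_of_le (a := ⁅x ^ p, y⁆) (b := ⁅x, y⁆ ^ p)
        (le_sup_right (a := ⁅powGen p (γ k), ⊤⁆)) (commutator_pow_eq_of_potent hp hpot k hx y)
      rw [← QuotientGroup.eq_one_iff, ← h1, QuotientGroup.eq_one_iff]
      exact Subgroup.mem_sup_left (Subgroup.commutator_mem_commutator (pow_mem_powGen hx) hy)
  refine le_antisymm (hle k) ?_
  have key : ∀ j, powGen p (γ (k + 1)) ≤ ⁅powGen p (γ k), ⊤⁆ ⊔ powGen p (γ (k + 1 + j)) := by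
    intro j
    induction j with
    | zero => exact le_sup_right
    | succ j ih =>
      refine ih.trans (sup_le le_sup_left ?_)
      have h1 := hge (k + j)
      rw [add_right_comm k 1 j]
      refine h1.trans (sup_le ((Subgroup.commutator_mono (powGen_mono
        (Subgroup.lowerCentralSeries_antitone ⊤ (Nat.le_add_right k j))) le_rfl).trans le_sup_left)
        ?_)
      refine le_trans (le_of_eq ?_) le_sup_right
      congr 2
      omega
  obtain ⟨n, hn⟩ := Subgroup.nilpotent_iff_lowerCentralSeries.mp ‹Group.IsNilpotent G›
  have hbot : powGen p (γ (k + 1 + n)) = ⊥ := by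
    rw [eq_bot_iff, ← hn]
    exact (powGen_le _).trans (Subgroup.lowerCentralSeries_antitone ⊤ (Nat.le_add_left _ _))
  simpa [hbot] using key n

lemma iterComm_powGen_top (hp : p.Prime) (hpot : γ (p - 2) ≤ powGen p ⊤) (k : ℕ) :
    iterComm (powGen p (⊤ : Subgroup G)) ⊤ k = powGen p (γ k) := by
  induction k with
  | zero => rfl
  | succ k ih => rw [iterComm, ih, commutator_powGen_lowerCentralSeries hp hpot]

/-- If `G` is potent, then `G ^ p` is powerful. -/
lemma commutator_powGen_top_le (hp : p.Prime) (hpot : γ (p - 2) ≤ powGen p ⊤) :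
    ⁅powGen p (⊤ : Subgroup G), powGen p (⊤ : Subgroup G)⁆ ≤ powGen p (powGen p ⊤) := by
  refine commutator_powGen_le fun x _ y hy => ?_
  have hanti := iterComm_antitone (A := powGen p (⊤ : Subgroup G)) (K := ⊤) (Nat.zero_le 2)
  have h := commutator_pow_prime_eq hp (A := powGen p ⊤) (K := ⊤) (X := powGen p (powGen p ⊤))
    le_top (fun g hg => pow_mem_powGen (hanti hg)) ?_
    (Subgroup.mem_top x) (Subgroup.mem_top y) (Or.inr hy)
  · rw [← QuotientGroup.eq_one_iff]
    rw [h, ← QuotientGroup.mk_pow, QuotientGroup.eq_one_iff]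
    exact pow_mem_powGen (Subgroup.commutator_le_right (⊤ : Subgroup G) _
      (Subgroup.commutator_mem_commutator (Subgroup.mem_top x) hy))
  · rw [iterComm_powGen_top hp hpot]
    exact (powGen_mono (Subgroup.lowerCentralSeries_antitone ⊤ (Nat.sub_le p 2))).trans
      (powGen_mono hpot)

/-- If `N` is powerful and `p` is odd, then `[N ^ (p ^ j), N] ≤ N ^ (p ^ (j + 1))`. -/
lemma commutator_powChain_le (hp : p.Prime) (hp2 : p ≠ 2) {N : Subgroup G} [N.Normal]
    (hN : ⁅N, N⁆ ≤ powGen p N) (j : ℕ) : ⁅powChain p N j, N⁆ ≤ powChain p N (j + 1) := by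
  have hp3 : 3 ≤ p := by have := hp.two_le; omega
  induction j with
  | zero => exact hN
  | succ j ih =>
    apply le_of_le_sup_commutator (K := N)
    refine commutator_powGen_le fun x hx y hy => ?_
    have hle : powChain p N j ≤ N := powChain_antitone (Nat.zero_le j)
    have h := commutator_pow_prime_eq hp (A := powChain p N j) (K := N)
      (X := powChain p N (j + 2) ⊔ ⁅⁅powChain p N (j + 1), N⁆, N⁆) hle (fun g hg => ?_) ?_
      (hle hx) hy (Or.inl hx)
    · rw [← QuotientGroup.eq_one_iff]
      rw [h, ← QuotientGroup.mk_pow, QuotientGroup.eq_one_iff]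
      exact Subgroup.mem_sup_left (pow_mem_powGen (ih (Subgroup.commutator_mem_commutator hx hy)))
    · exact Subgroup.mem_sup_left (pow_mem_powGen (ih (iterComm_antitone one_le_two hg)))
    · refine (iterComm_antitone hp3).trans (le_trans ?_ le_sup_right)
      exact Subgroup.commutator_mono (Subgroup.commutator_mono ih le_rfl) le_rfl

/-- The `p`-th power maps between the factors of the `p`-power series of a powerful group are
homomorphisms, for `p` odd. -/
lemma isPowMulChain_of_powerful (hp : p.Prime) (hp2 : p ≠ 2) {N : Subgroup G} [N.Normal]
    (hN : ⁅N, N⁆ ≤ powGen p N) : IsPowMulChain p N := by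
  intro j x hx y hy
  have h1 := commutator_powChain_le hp hp2 hN j
  refine mul_pow_prime_eq hp (A := powChain p N j) (K := N) (powChain_antitone (Nat.zero_le j))
    (fun g hg => pow_mem_powGen (h1 hg)) ?_ hx hy
  have hp3 : 2 ≤ p - 1 := by have := hp.two_le; omega
  exact (iterComm_antitone hp3).trans ((Subgroup.commutator_mono h1 le_rfl).trans
    (commutator_powChain_le hp hp2 hN (j + 1)))

/-- In a `2`-group with `G' ≤ G ^ 4`, the `2`-power series is strongly central. -/
lemma commutator_powChain_two_le (h : ⁅(⊤ : Subgroup G), (⊤ : Subgroup G)⁆ ≤ powChain 2 ⊤ 2)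
    (j : ℕ) :
    ⁅powChain 2 (⊤ : Subgroup G) j, (⊤ : Subgroup G)⁆ ≤ powChain 2 ⊤ (j + 2) := by
  have hsq : ∀ x y : G, ⁅x ^ 2, y⁆ = ⁅x, ⁅x, y⁆⁆ * ⁅x, y⁆ ^ 2 := fun x y => by
    simp only [commutatorElement_def, pow_two]
    group
  induction j with
  | zero => exact h
  | succ j ih =>
    have hB : ⁅powChain 2 (⊤ : Subgroup G) (j + 1), (⊤ : Subgroup G)⁆ ≤ powChain 2 ⊤ (j + 2) :=
      (Subgroup.commutator_mono (powChain_antitone (Nat.le_succ j)) le_rfl).trans ih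
    have h2 : ⁅powChain 2 (⊤ : Subgroup G) (j + 2), (⊤ : Subgroup G)⁆ ≤
        powChain 2 ⊤ (j + 3) ⊔
          ⁅⁅powChain 2 (⊤ : Subgroup G) (j + 1), (⊤ : Subgroup G)⁆, (⊤ : Subgroup G)⁆ := by
      refine commutator_powGen_le fun x hx y _ => ?_
      have hc := Subgroup.commutator_mem_commutator hx (Subgroup.mem_top y)
      rw [hsq]
      refine mul_mem (Subgroup.mem_sup_right ?_) (Subgroup.mem_sup_left (pow_mem_powGen (hB hc)))
      rw [Subgroup.commutator_comm _ ⊤]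
      exact Subgroup.commutator_mem_commutator (Subgroup.mem_top x) hc
    apply le_of_le_sup_commutator (K := ⊤)
    refine commutator_powGen_le fun x hx y _ => ?_
    have hc := Subgroup.commutator_mem_commutator hx (Subgroup.mem_top y)
    rw [hsq]
    refine mul_mem ?_ (Subgroup.mem_sup_left (pow_mem_powGen (ih hc)))
    apply h2
    rw [Subgroup.commutator_comm _ ⊤]
    exact Subgroup.commutator_mem_commutator (Subgroup.mem_top x) (ih hc)

lemma isPowMulChain_two (h : ⁅(⊤ : Subgroup G), (⊤ : Subgroup G)⁆ ≤ powChain 2 ⊤ 2) :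
    IsPowMulChain 2 (⊤ : Subgroup G) := by
  intro j x hx y _
  have hc := commutator_powChain_two_le h j
    (Subgroup.commutator_mem_commutator hx (Subgroup.mem_top y))
  have h1 : Commute (x : G ⧸ powChain 2 (⊤ : Subgroup G) (j + 2)) y :=
    commutatorElement_eq_one_iff_commute.mp ((QuotientGroup.eq_one_iff _).mpr hc)
  exact h1.mul_pow 2

end Potent

/-! ### The top power map of a potent `p`-group -/

section TopPower

variable {G : Type*} [Group G] {p : ℕ}

lemma pow_mem_commutator_top {N B C : Subgroup G} [B.Normal] {m : ℕ}
    (hN : ∀ x ∈ N, ∀ y ∈ N, (x * y) ^ m = x ^ m * y ^ m) (hBN : B ≤ N)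
    (hBC : ∀ b ∈ B, b ^ m ∈ C) {z : G} (hz : z ∈ ⁅B, (⊤ : Subgroup G)⁆) :
    z ^ m ∈ ⁅C, (⊤ : Subgroup G)⁆ := by
  have hle : ⁅B, (⊤ : Subgroup G)⁆ ≤ N := (Subgroup.commutator_le_left B ⊤).trans hBN
  rw [Subgroup.commutator_def] at hz hle
  induction hz using Subgroup.closure_induction with
  | mem x hx =>
    obtain ⟨b, hb, g, hg, rfl⟩ := hx
    have h1 : ⁅b, g⁆ = b * (g * b⁻¹ * g⁻¹) := by simp only [commutatorElement_def]; group
    have h2 : ⁅b, g⁆ ^ m = ⁅b ^ m, g⁆ := by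
      rw [h1, hN b (hBN hb) _ (hBN (‹B.Normal›.conj_mem _ (inv_mem hb) g)), conj_pow, inv_pow]
      simp only [commutatorElement_def]
      group
    rw [h2]
    exact Subgroup.commutator_mem_commutator (hBC b hb) hg
  | one => simp
  | mul x y hx hy ihx ihy =>
    rw [hN x (hle hx) y (hle hy)]
    exact mul_mem ihx ihy
  | inv x _ ih => simpa using ih

lemma isSemiPrimePowAbelian_of_mul_pow {i : ℕ}
    (h : ∀ x y : G, (x * y) ^ p ^ i = x ^ p ^ i * y ^ p ^ i) : IsSemiPrimePowAbelian p i G := by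
  intro x y
  have hxy := h (x * y⁻¹) y
  rw [inv_mul_cancel_right] at hxy
  rw [hxy, mul_eq_right]

variable [Finite G] [Fact p.Prime]

/-- For a potent `p`-group of exponent dividing `p ^ (f + 2)` with `p` odd, put `n = p ^ (f + 1)`
and `V = G ^ n`. The `n`-th power map is multiplicative modulo `[V, G]`, and commutes with
commutators modulo `[V, G, G]`. -/
theorem pow_map_of_potent (hG : IsPGroup p G) (hp2 : p ≠ 2) (hpot : IsPotent p G) {f : ℕ}
    (hexp : ∀ g : G, g ^ p ^ (f + 2) = 1) {V : Subgroup G}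
    (hV : V = powerSubgroup G (p ^ (f + 1))) [V.Normal] :
    (∀ x y : G, (((x * y) ^ p ^ (f + 1) : G) : G ⧸ ⁅V, (⊤ : Subgroup G)⁆) =
      (x ^ p ^ (f + 1) * y ^ p ^ (f + 1) : G)) ∧
    (∀ x y : G, ((⁅x ^ p ^ (f + 1), y⁆ : G) :
      G ⧸ ⁅⁅V, (⊤ : Subgroup G)⁆, (⊤ : Subgroup G)⁆) = (⁅x, y⁆ ^ p ^ (f + 1) : G)) ∧
    (p = 3 → ⁅V, (⊤ : Subgroup G)⁆ = ⊥) := by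
  have hp : p.Prime := Fact.out
  have := hG.isNilpotent
  have hpot' := hpot.1 hp2
  rw [← powGen_top] at hpot'
  have hN1 : powGen p (⊤ : Subgroup G) = powerSubgroup G (p ^ 1) := by rw [powGen_top, pow_one]
  have hpow := commutator_powGen_top_le hp hpot'
  rw [hN1] at hpow
  have hchain := isPowMulChain_of_powerful hp hp2 hpow
  have hmul : ∀ x ∈ powerSubgroup G (p ^ 1), ∀ y ∈ powerSubgroup G (p ^ 1),
      (x * y) ^ p ^ f = x ^ p ^ f * y ^ p ^ f := fun x hx y hy =>
    hchain.mul_pow_eq hG (fun g => by rw [show 1 + (f + 1) = f + 2 by ring]; exact hexp g) hx hy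
  have hkill : ∀ x ∈ powGen p (powerSubgroup G (p ^ 1)), x ^ p ^ f = 1 := fun x hx => by
    have h1 := pow_mem_powChain (A := powerSubgroup G (p ^ 1)) (j := 1) (k := f) hx
    rwa [hchain.powChain_eq_bot hG (k := 1 + f) (fun g => by
      rw [show 1 + (1 + f) = f + 2 by ring]; exact hexp g), Subgroup.mem_bot] at h1
  rw [← hN1] at hmul hkill
  set N := powGen p (⊤ : Subgroup G)
  have hNp : ∀ x : G, x ^ p ∈ N := fun x => pow_mem_powGen (Subgroup.mem_top x)
  have hsplit : ∀ x : G, x ^ p ^ (f + 1) = (x ^ p) ^ p ^ f := fun x => by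
    rw [← pow_mul, pow_succ']
  have hNV : ∀ x ∈ N, x ^ p ^ f ∈ V := by
    intro x hx
    change x ∈ Subgroup.closure _ at hx
    have hle : Subgroup.closure ((fun g : G => g ^ p) '' (⊤ : Subgroup G)) ≤ N := le_rfl
    induction hx using Subgroup.closure_induction with
    | mem x hx =>
      obtain ⟨y, -, rfl⟩ := hx
      beta_reduce
      rw [← hsplit, hV]
      exact pow_mem_powerSubgroup y _
    | one => simp
    | mul x y hx hy ihx ihy => rw [hmul x (hle hx) y (hle hy)]; exact mul_mem ihx ihy
    | inv x _ ih => simpa using ih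
  have hE1 : ⁅N, (⊤ : Subgroup G)⁆ ≤ N := Subgroup.commutator_le_left N ⊤
  have hV2 : ∀ z ∈ ⁅N, (⊤ : Subgroup G)⁆, z ^ p ^ f ∈ ⁅V, (⊤ : Subgroup G)⁆ := fun z hz =>
    pow_mem_commutator_top hmul le_rfl hNV hz
  have hV3 : ∀ z ∈ ⁅⁅N, (⊤ : Subgroup G)⁆, (⊤ : Subgroup G)⁆,
      z ^ p ^ f ∈ ⁅⁅V, (⊤ : Subgroup G)⁆, (⊤ : Subgroup G)⁆ := fun z hz =>
    pow_mem_commutator_top hmul hE1 hV2 hz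
  have hcx : ∀ x y : G, ⁅x ^ p, y⁆ ^ p ^ f = ⁅x ^ p ^ (f + 1), y⁆ := fun x y => by
    have h1 : ⁅x ^ p, y⁆ = x ^ p * (y * (x ^ p)⁻¹ * y⁻¹) := by
      simp only [commutatorElement_def]; group
    rw [h1, hmul _ (hNp x) _ ((powGen_normal ⊤).conj_mem _ (inv_mem (hNp x)) y), conj_pow,
      inv_pow, ← hsplit]
    simp only [commutatorElement_def]
    group
  refine ⟨fun x y => ?_, fun x y => ?_, fun h3 => ?_⟩
  · have h1 : (((x ^ p * y ^ p : G)) : G ⧸ ⁅N, (⊤ : Subgroup G)⁆) = ((x * y) ^ p : G) := by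
      have h := mul_pow_eq_of_potent hp hpot' 0 (Subgroup.mem_top x) (Subgroup.mem_top y)
      exact mk_eq_mk_of_le (a := x ^ p * y ^ p) (b := (x * y) ^ p)
        (iterComm_powGen_top hp hpot' 1).ge h.symm
    rw [QuotientGroup.eq] at h1
    refine (QuotientGroup.eq.mpr ?_).symm
    have h2 := hV2 _ h1
    rw [hmul _ (inv_mem (mul_mem (hNp x) (hNp y))) _ (hNp _), inv_pow, hmul _ (hNp x) _ (hNp y)]
      at h2
    rwa [← hsplit, ← hsplit, ← hsplit] at h2
  · have h1 : ((⁅x, y⁆ ^ p : G) : G ⧸ ⁅⁅N, (⊤ : Subgroup G)⁆, (⊤ : Subgroup G)⁆) =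
        (⁅x ^ p, y⁆ : G) := by
      have h := commutator_pow_eq_of_potent hp hpot' 0 (Subgroup.mem_top x) y
      exact mk_eq_mk_of_le (a := ⁅x, y⁆ ^ p) (b := ⁅x ^ p, y⁆)
        (iterComm_powGen_top hp hpot' 2).ge h.symm
    rw [QuotientGroup.eq] at h1
    refine (QuotientGroup.eq.mpr ?_).symm
    have h2 := hV3 _ h1
    rw [hmul _ (inv_mem (hNp _)) _
      (hE1 (Subgroup.commutator_mem_commutator (hNp x) (Subgroup.mem_top y))), inv_pow] at h2
    rwa [← hsplit, hcx] at h2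
  · subst h3
    rw [eq_bot_iff, hV, powerSubgroup]
    refine commutator_closure_le ?_
    rintro _ ⟨x, rfl⟩ y -
    rw [Subgroup.mem_bot, ← hcx]
    refine hkill _ (powGen_mono hpot' ?_)
    rw [← iterComm_powGen_top hp hpot']
    exact Subgroup.commutator_mem_commutator (hNp x) (Subgroup.mem_top y)

/-- For `p = 2`, the top power map of a potent group is a homomorphism. -/
theorem mul_pow_of_potent_two {G : Type*} [Group G] [Finite G] (hG : IsPGroup 2 G)
    (hpot : IsPotent 2 G) {k : ℕ} (hexp : ∀ g : G, g ^ 2 ^ (k + 1) = 1) (x y : G) :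
    (x * y) ^ 2 ^ k = x ^ 2 ^ k * y ^ 2 ^ k := by
  have := hG.isNilpotent
  have := Fact.mk Nat.prime_two
  have h4 : powerSubgroup G 4 ≤ powChain 2 ⊤ 2 := by
    rw [powerSubgroup, Subgroup.closure_le]
    rintro _ ⟨g, rfl⟩
    have h0 : g ∈ powChain 2 (⊤ : Subgroup G) 0 := Subgroup.mem_top g
    have h : g ^ 2 ^ 2 ∈ powChain 2 (⊤ : Subgroup G) (0 + 2) := pow_mem_powChain h0
    rwa [show 2 ^ 2 = 4 by norm_num] at h
  have htop : ∀ g : G, g ∈ powerSubgroup G (2 ^ 0) := fun g => by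
    have h := pow_mem_powerSubgroup g (2 ^ 0)
    rw [pow_zero] at h ⊢
    rwa [pow_one] at h
  have hchain : ∀ A : Subgroup G, [A.Normal] → A = ⊤ → IsPowMulChain 2 A := by
    rintro _ _ rfl
    exact isPowMulChain_two ((hpot.2 rfl).trans h4)
  exact (hchain _ ((Subgroup.eq_top_iff' _).mpr htop)).mul_pow_eq hG
    (fun g => by rw [zero_add]; exact hexp g) (htop x) (htop y)

/-- Let `V = G ^ n` in a `2`-generator `p`-group `G`, and suppose that taking `n`-th powers is
multiplicative modulo `[V, G]` and commutes with commutators modulo `[V, G, G]`. If some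
`x` outside the Frattini subgroup satisfies `x ^ n ∈ [V, G]`, then, for `G = ⟨x, y⟩`, the factor
`[V, G] / [V, G, G]` is generated by `[y ^ n, x] ≡ [x ^ n, y]⁻¹ ≡ 1`, so `[V, G] = 1`. -/
theorem commutator_eq_bot_or_mem_frattini (hG : IsPGroup p G)
    (h2 : ∃ a b : G, Subgroup.closure {a, b} = ⊤) {n : ℕ} {V : Subgroup G}
    (hV : V = powerSubgroup G n) [V.Normal]
    (hmul : ∀ x y : G, (((x * y) ^ n : G) : G ⧸ ⁅V, (⊤ : Subgroup G)⁆) = (x ^ n * y ^ n : G))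
    (hcomm : ∀ x y : G, ((⁅x ^ n, y⁆ : G) :
      G ⧸ ⁅⁅V, (⊤ : Subgroup G)⁆, (⊤ : Subgroup G)⁆) = (⁅x, y⁆ ^ n : G)) :
    ⁅V, (⊤ : Subgroup G)⁆ = ⊥ ∨ ∀ x : G, x ^ n ∈ ⁅V, (⊤ : Subgroup G)⁆ → x ∈ frattini G := by
  have := hG.isNilpotent
  rw [or_iff_not_imp_right]
  push Not
  rintro ⟨x, hxn, hx⟩
  obtain ⟨y, hxy⟩ := hG.exists_closure_pair_eq_top h2 hx
  set V₂ := ⁅V, (⊤ : Subgroup G)⁆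
  have hVle : V ≤ Subgroup.closure ({y ^ n} ∪ (V₂ : Set G)) := by
    rw [hV, powerSubgroup, Subgroup.closure_le]
    rintro _ ⟨g, rfl⟩
    have hg : g ∈ Subgroup.closure {x, y} := hxy ▸ Subgroup.mem_top g
    induction hg using Subgroup.closure_induction with
    | mem g hg =>
      rcases hg with rfl | rfl
      · exact Subgroup.subset_closure (Or.inr hxn)
      · exact Subgroup.subset_closure (Or.inl rfl)
    | one => simp
    | mul a b _ _ ha hb =>
      have h := QuotientGroup.eq.mp (hmul a b).symm
      have hab := mul_mem (mul_mem ha hb) (Subgroup.subset_closure (Or.inr h))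
      rwa [mul_inv_cancel_left] at hab
    | inv a _ ha => simpa using ha
  have hyk : ∀ k : G, ⁅y ^ n, k⁆ ∈ ⁅V₂, (⊤ : Subgroup G)⁆ := by
    intro k
    have hiff : ∀ k : G, ⁅y ^ n, k⁆ ∈ ⁅V₂, (⊤ : Subgroup G)⁆ ↔
        Commute ((y ^ n : G) : G ⧸ ⁅V₂, (⊤ : Subgroup G)⁆) (k : G ⧸ ⁅V₂, (⊤ : Subgroup G)⁆) :=
      fun k => by
        rw [← QuotientGroup.eq_one_iff, ← commutatorElement_eq_one_iff_commute]
        rfl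
    rw [hiff]
    have hk : k ∈ Subgroup.closure {x, y} := hxy ▸ Subgroup.mem_top k
    induction hk using Subgroup.closure_induction with
    | mem k hk =>
      rw [← hiff]
      rcases hk with rfl | rfl
      · rw [← QuotientGroup.eq_one_iff, hcomm, ← commutatorElement_inv, inv_pow,
          QuotientGroup.mk_inv, ← hcomm, inv_eq_one, QuotientGroup.eq_one_iff]
        exact Subgroup.commutator_mem_commutator hxn (Subgroup.mem_top y)
      · rw [commutatorElement_eq_one_iff_commute.mpr ((Commute.refl _).pow_left n)]
        exact one_mem _
    | one => exact Commute.one_right _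
    | mul a b _ _ ha hb => exact ha.mul_right hb
    | inv a _ ha => exact ha.inv_right
  have hle : V₂ ≤ ⊥ ⊔ ⁅V₂, (⊤ : Subgroup G)⁆ := by
    rw [bot_sup_eq]
    refine (Subgroup.commutator_mono hVle le_rfl).trans (commutator_closure_le ?_)
    rintro s (rfl | hs) k hk
    · exact hyk k
    · exact Subgroup.commutator_mem_commutator hs hk
  exact le_bot_iff.mp (le_of_le_sup_commutator hle)

lemma IsPGroup.prime_sq_le_card_or_card_dvd (hG : IsPGroup p G) (V : Subgroup G) :
    p ^ 2 ≤ Nat.card V ∨ Nat.card V ∣ p := by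
  obtain ⟨a, ha⟩ := IsPGroup.iff_card.mp (hG.to_subgroup V)
  rw [ha]
  rcases lt_or_ge a 2 with h | h
  · exact Or.inr (by simpa using pow_dvd_pow p (Nat.lt_succ_iff.mp h))
  · exact Or.inl (Nat.pow_le_pow_right (Fact.out : p.Prime).pos h)

/-- A `2`-generator potent `p`-group `G` of exponent `p ^ e` is semi-`p ^ (e - 1)`-abelian, or else
`p ≥ 5`, the order of `G ^ (p ^ (e - 1))` is at least `p ^ 2`, and elements with equal
`p ^ (e - 1)`-th powers are congruent modulo the Frattini subgroup. -/
theorem IsPotent.semi_or (hG : IsPGroup p G) (h2 : ∃ a b : G, Subgroup.closure {a, b} = ⊤)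
    (hpot : IsPotent p G) {i : ℕ} (hexp : ∀ g : G, g ^ p ^ (i + 1) = 1) :
    IsSemiPrimePowAbelian p i G ∨ (5 ≤ p ∧ p ^ 2 ≤ Nat.card (powerSubgroup G (p ^ i)) ∧
      ∀ u v : G, u ^ p ^ i = v ^ p ^ i → u * v⁻¹ ∈ frattini G) := by
  have hp : p.Prime := Fact.out
  have := hG.isNilpotent
  rcases i with _ | f
  · exact Or.inl (isSemiPrimePowAbelian_of_mul_pow fun x y => by simp)
  by_cases hp2 : p = 2
  · subst hp2
    exact Or.inl (isSemiPrimePowAbelian_of_mul_pow (mul_pow_of_potent_two hG hpot hexp))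
  obtain ⟨V, hV⟩ : ∃ V, V = powerSubgroup G (p ^ (f + 1)) := ⟨_, rfl⟩
  have hVn : V.Normal := hV ▸ powerSubgroup_normal _
  obtain ⟨hmul, hcomm, h3⟩ := pow_map_of_potent hG hp2 hpot hexp hV
  by_cases hV2 : ⁅V, (⊤ : Subgroup G)⁆ = ⊥
  · refine Or.inl (isSemiPrimePowAbelian_of_mul_pow fun x y => ?_)
    have h := QuotientGroup.eq.mp (hmul x y)
    rw [hV2, Subgroup.mem_bot] at h
    exact inv_mul_eq_one.mp h
  · have hker := (commutator_eq_bot_or_mem_frattini hG h2 hV hmul hcomm).resolve_left hV2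
    refine Or.inr ⟨?_, ?_, fun u v huv => hker _ ?_⟩
    · have h4 : p ≠ 4 := fun h => by rw [h] at hp; norm_num at hp
      have := hp.two_le
      have : p ≠ 3 := fun h => hV2 (h3 h)
      omega
    · rw [← hV]
      refine (hG.prime_sq_le_card_or_card_dvd V).resolve_right fun h => hV2 ?_
      have hdvd : Nat.card (⁅V, (⊤ : Subgroup G)⁆ : Subgroup G) ∣ Nat.card V :=
        Subgroup.card_dvd_of_le (Subgroup.commutator_le_left V ⊤)
      rcases (Nat.dvd_prime hp).mp h with h1 | h1
      · rw [Subgroup.card_eq_one.mp h1, Subgroup.commutator_bot_left]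
      rcases (Nat.dvd_prime hp).mp (h1 ▸ hdvd) with h5 | h5
      · exact Subgroup.card_eq_one.mp h5
      · have heq : ⁅V, (⊤ : Subgroup G)⁆ = V := Subgroup.eq_of_le_of_card_ge
          (Subgroup.commutator_le_left V ⊤) (by rw [h1, h5])
        have hbot : V ≤ ⊥ := le_of_le_sup_commutator (K := ⊤) (by rw [heq]; exact le_sup_right)
        rwa [heq, eq_bot_iff]
    · have h := QuotientGroup.eq.mp (hmul (u * v⁻¹) v)
      rw [inv_mul_cancel_right, huv] at h
      have h' := (Subgroup.commutator_normal V ⊤).mem_comm h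
      rwa [mul_inv_cancel_right] at h'

end TopPower

/-! ### Beauville structures and quotients -/

section Beauville

variable {G : Type*} [Group G]

lemma mem_beauvilleSigma {x y z : G} : z ∈ beauvilleSigma x y ↔
    ∃ a ∈ ({x, y, x * y} : Set G), ∃ (i : ℤ) (g : G), z = g⁻¹ * a ^ i * g := by
  simp only [beauvilleSigma, Set.mem_iUnion, Set.mem_image, Set.mem_union, SetLike.mem_coe,
    Subgroup.mem_zpowers_iff, Set.mem_insert_iff, Set.mem_singleton_iff]
  constructor
  · rintro ⟨g, _, (⟨i, rfl⟩ | ⟨i, rfl⟩) | ⟨i, rfl⟩, rfl⟩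
    · exact ⟨x, by simp, i, g, rfl⟩
    · exact ⟨y, by simp, i, g, rfl⟩
    · exact ⟨x * y, by simp, i, g, rfl⟩
  · rintro ⟨a, rfl | rfl | rfl, i, g, rfl⟩
    · exact ⟨g, _, Or.inl (Or.inl ⟨i, rfl⟩), rfl⟩
    · exact ⟨g, _, Or.inl (Or.inr ⟨i, rfl⟩), rfl⟩
    · exact ⟨g, _, Or.inr ⟨i, rfl⟩, rfl⟩

lemma conj_zpow_mem_beauvilleSigma {x y a : G} (ha : a ∈ ({x, y, x * y} : Set G)) (i : ℤ) (g : G) :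
    g⁻¹ * a ^ i * g ∈ beauvilleSigma x y :=
  mem_beauvilleSigma.mpr ⟨a, ha, i, g, rfl⟩

lemma zpow_mem_beauvilleSigma {x y a : G} (ha : a ∈ ({x, y, x * y} : Set G)) (i : ℤ) :
    a ^ i ∈ beauvilleSigma x y := by
  simpa using conj_zpow_mem_beauvilleSigma ha i 1

lemma one_mem_beauvilleSigma (x y : G) : (1 : G) ∈ beauvilleSigma x y := by
  simpa using zpow_mem_beauvilleSigma (x := x) (y := y) (a := x) (by simp) 0

lemma pow_mem_beauvilleSigma {x y z : G} (hz : z ∈ beauvilleSigma x y) (n : ℕ) :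
    z ^ n ∈ beauvilleSigma x y := by
  obtain ⟨a, ha, i, g, rfl⟩ := mem_beauvilleSigma.mp hz
  refine mem_beauvilleSigma.mpr ⟨a, ha, i * n, g, ?_⟩
  have h := conj_pow (a := g⁻¹) (b := a ^ i) (i := n)
  rw [inv_inv] at h
  rw [h, zpow_mul, zpow_natCast]

lemma mk_mem_beauvilleSigma (N : Subgroup G) [N.Normal] {x y z : G}
    (hz : z ∈ beauvilleSigma x y) :
    (z : G ⧸ N) ∈ beauvilleSigma (x : G ⧸ N) (y : G ⧸ N) := by
  obtain ⟨a, ha, i, g, rfl⟩ := mem_beauvilleSigma.mp hz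
  refine mem_beauvilleSigma.mpr ⟨a, ?_, i, g, rfl⟩
  rcases ha with rfl | rfl | rfl <;> simp

lemma exists_mk_of_mem_beauvilleSigma (N : Subgroup G) [N.Normal] {x y : G} {z : G ⧸ N}
    (hz : z ∈ beauvilleSigma (x : G ⧸ N) (y : G ⧸ N)) :
    ∃ w ∈ beauvilleSigma x y, (w : G ⧸ N) = z := by
  obtain ⟨a, ha, i, g, rfl⟩ := mem_beauvilleSigma.mp hz
  induction g using QuotientGroup.induction_on with | H g
  rcases ha with rfl | rfl | rfl
  · exact ⟨_, conj_zpow_mem_beauvilleSigma (a := x) (by simp) i g, rfl⟩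
  · exact ⟨_, conj_zpow_mem_beauvilleSigma (a := y) (by simp) i g, rfl⟩
  · exact ⟨_, conj_zpow_mem_beauvilleSigma (a := x * y) (by simp) i g, rfl⟩

lemma closure_pair_eq_top_of_frattini [Finite G] {x y : G}
    (h : Subgroup.closure {(x : G ⧸ frattini G), (y : G ⧸ frattini G)} = ⊤) :
    Subgroup.closure {x, y} = ⊤ := by
  apply frattini_nongenerating
  have h1 : (Subgroup.closure {x, y}).map (QuotientGroup.mk' (frattini G)) = ⊤ := by
    rw [MonoidHom.map_closure, Set.image_pair]
    exact h
  have h2 := congrArg (Subgroup.comap (QuotientGroup.mk' (frattini G))) h1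
  rwa [Subgroup.comap_map_eq, QuotientGroup.ker_mk', Subgroup.comap_top] at h2

lemma IsBeauvilleStructure.eq_one {x₁ y₁ x₂ y₂ z : G} (h : IsBeauvilleStructure x₁ y₁ x₂ y₂)
    (h1 : z ∈ beauvilleSigma x₁ y₁) (h2 : z ∈ beauvilleSigma x₂ y₂) : z = 1 := by
  have hz : z ∈ beauvilleSigma x₁ y₁ ∩ beauvilleSigma x₂ y₂ := ⟨h1, h2⟩
  rwa [h.2.2] at hz

lemma isBeauvilleStructure_iff {x₁ y₁ x₂ y₂ : G} : IsBeauvilleStructure x₁ y₁ x₂ y₂ ↔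
    Subgroup.closure {x₁, y₁} = ⊤ ∧ Subgroup.closure {x₂, y₂} = ⊤ ∧
      ∀ z ∈ beauvilleSigma x₁ y₁, z ∈ beauvilleSigma x₂ y₂ → z = 1 := by
  refine ⟨fun h => ⟨h.1, h.2.1, fun z h1 h2 => h.eq_one h1 h2⟩, fun h => ⟨h.1, h.2.1, ?_⟩⟩
  ext z
  refine ⟨fun hz => h.2.2 z hz.1 hz.2, ?_⟩
  rintro rfl
  exact ⟨one_mem_beauvilleSigma _ _, one_mem_beauvilleSigma _ _⟩

lemma IsBeauvilleStructure.symm {x₁ y₁ x₂ y₂ : G} (h : IsBeauvilleStructure x₁ y₁ x₂ y₂) :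
    IsBeauvilleStructure x₂ y₂ x₁ y₁ :=
  isBeauvilleStructure_iff.mpr ⟨h.2.1, h.1, fun _ h1 h2 => h.eq_one h2 h1⟩

/-- If the entries of a triple `x, y, xy` of a Beauville structure of `G` include `1`, then `G`
is cyclic and its union `Σ(x, y)` is all of `G`, so that the other pair is trivial. -/
lemma IsBeauvilleStructure.one_notMem [Nontrivial G] {x₁ y₁ x₂ y₂ : G}
    (h : IsBeauvilleStructure x₁ y₁ x₂ y₂) : (1 : G) ∉ ({x₁, y₁, x₁ * y₁} : Set G) := by
  intro h1
  obtain ⟨a, ha, hatop⟩ : ∃ a ∈ ({x₁, y₁, x₁ * y₁} : Set G), Subgroup.zpowers a = ⊤ := by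
    have key : ∀ a : G, x₁ ∈ Subgroup.zpowers a → y₁ ∈ Subgroup.zpowers a →
        Subgroup.zpowers a = ⊤ := fun a hx hy => by
      rw [← top_le_iff, ← h.1, Subgroup.closure_le]
      rintro _ (rfl | rfl) <;> assumption
    rcases h1 with h1 | h1 | h1
    · exact ⟨y₁, by simp, key _ (h1 ▸ one_mem _) (Subgroup.mem_zpowers _)⟩
    · exact ⟨x₁, by simp, key _ (Subgroup.mem_zpowers _) (h1 ▸ one_mem _)⟩
    · have hy : y₁ = x₁⁻¹ := (inv_eq_of_mul_eq_one_right h1.symm).symm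
      exact ⟨x₁, by simp, key _ (Subgroup.mem_zpowers _)
        (hy ▸ inv_mem (Subgroup.mem_zpowers _))⟩
  have hall : ∀ z : G, z ∈ beauvilleSigma x₁ y₁ := fun z => by
    obtain ⟨i, rfl⟩ := Subgroup.mem_zpowers_iff.mp (hatop ▸ Subgroup.mem_top z)
    exact zpow_mem_beauvilleSigma ha i
  have hx := h.eq_one (hall x₂) (by simpa using zpow_mem_beauvilleSigma (a := x₂) (by simp) 1)
  have hy := h.eq_one (hall y₂) (by simpa using zpow_mem_beauvilleSigma (a := y₂) (by simp) 1)
  have := h.2.1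
  rw [hx, hy, Set.pair_eq_singleton, Subgroup.closure_singleton_one] at this
  exact bot_ne_top this

variable [Finite G] {p : ℕ} [Fact p.Prime]

lemma nontrivial_quotient_frattini [Nontrivial G] : Nontrivial (G ⧸ frattini G) := by
  rw [QuotientGroup.nontrivial_iff]
  intro h
  have : (⊥ : Subgroup G) = ⊤ := frattini_nongenerating (by rw [h, sup_top_eq])
  exact bot_ne_top this

/-- If elements of `G` with equal `p ^ i`-th powers are congruent modulo the Frattini subgroup,
where the exponent of `G` divides `p ^ (i + 1)`, then Beauville structures of `G / Φ(G)` lift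
to `G`. -/
theorem IsBeauvilleStructure.lift [Nontrivial G] (hG : IsPGroup p G) {i : ℕ}
    (hexp : ∀ g : G, g ^ p ^ (i + 1) = 1)
    (hL : ∀ u v : G, u ^ p ^ i = v ^ p ^ i → u * v⁻¹ ∈ frattini G) {x₁ y₁ x₂ y₂ : G}
    (h : IsBeauvilleStructure (x₁ : G ⧸ frattini G) (y₁ : G ⧸ frattini G)
        (x₂ : G ⧸ frattini G) (y₂ : G ⧸ frattini G)) : IsBeauvilleStructure x₁ y₁ x₂ y₂ := by
  have hp : p.Prime := Fact.out
  have := nontrivial_quotient_frattini (G := G)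
  refine isBeauvilleStructure_iff.mpr ⟨closure_pair_eq_top_of_frattini h.1,
    closure_pair_eq_top_of_frattini h.2.1, fun z hz₁ hz₂ => ?_⟩
  by_contra hz
  -- replace `z` by a power of order `p`
  obtain ⟨s, hs⟩ := IsPGroup.iff_orderOf.mp hG z
  obtain ⟨s, rfl⟩ : ∃ t, s = t + 1 := by
    refine ⟨s - 1, ?_⟩
    have : s ≠ 0 := by
      rintro rfl
      exact hz (by simpa using hs)
    omega
  have hzo : orderOf (z ^ p ^ s) = p := by
    rw [orderOf_pow_of_dvd (pow_ne_zero _ hp.ne_zero) (hs ▸ pow_dvd_pow p (Nat.le_succ s)), hs,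
      pow_succ, Nat.mul_div_cancel_left _ (pow_pos hp.pos s)]
  -- an element of order `p` of `Σ(x, y)` is the `p ^ i`-th power of an element of `Σ(x, y)`
  have key : ∀ {x y x' y' : G}, IsBeauvilleStructure (x : G ⧸ frattini G) (y : G ⧸ frattini G)
      (x' : G ⧸ frattini G) (y' : G ⧸ frattini G) → z ∈ beauvilleSigma x y →
      ∃ w ∈ beauvilleSigma x y, w ^ p ^ i = z ^ p ^ s ∧ w ∉ frattini G := by
    intro x y x' y' hxy hzxy
    obtain ⟨a, ha, k, g, hk⟩ := mem_beauvilleSigma.mp (pow_mem_beauvilleSigma hzxy (p ^ s))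
    have haF : a ∉ frattini G := by
      intro haF
      apply hxy.one_notMem
      rw [← (QuotientGroup.eq_one_iff a).mpr haF]
      rcases ha with rfl | rfl | rfl <;> simp
    have hai : ¬ a ^ p ^ i = 1 := fun h1 => haF (by simpa using hL a 1 (by simpa using h1))
    have hao : orderOf a = p ^ (i + 1) := orderOf_eq_prime_pow hai (hexp a)
    have hconj : ∀ (l : ℤ) (n : ℕ), (g⁻¹ * a ^ l * g) ^ n = g⁻¹ * a ^ (l * n) * g := fun l n => by
      have h := conj_pow (a := g⁻¹) (b := a ^ l) (i := n)
      rw [inv_inv] at h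
      rw [h, zpow_mul, zpow_natCast]
    have hkp : a ^ (k * p) = 1 := by
      have h1 : (z ^ p ^ s) ^ p = 1 := by rw [← orderOf_dvd_iff_pow_eq_one, hzo]
      rw [hk, hconj] at h1
      simpa [mul_assoc, mul_eq_one_iff_eq_inv] using h1
    rw [← orderOf_dvd_iff_zpow_eq_one, hao, pow_succ, Nat.cast_mul] at hkp
    obtain ⟨m, rfl⟩ := Int.dvd_of_mul_dvd_mul_right (by exact_mod_cast hp.ne_zero) hkp
    refine ⟨g⁻¹ * a ^ m * g, conj_zpow_mem_beauvilleSigma ha m g, ?_, fun hw => ?_⟩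
    · rw [hconj, hk, mul_comm m]
    · have ham : a ^ m ∈ frattini G := by
        have h1 := (inferInstance : (frattini G).Normal).conj_mem _ hw g
        simpa [mul_assoc] using h1
      by_cases hpm : (p : ℤ) ∣ m
      · obtain ⟨l, rfl⟩ := hpm
        have h1 : z ^ p ^ s = 1 := by
          rw [hk, ← mul_assoc, zpow_mul, show ((p ^ i : ℕ) : ℤ) * p = ((p ^ (i + 1) : ℕ) : ℤ) by
            rw [pow_succ, Nat.cast_mul], zpow_natCast, hexp]
          simp
        rw [h1, orderOf_one] at hzo
        exact hp.one_lt.ne hzo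
      · obtain ⟨c, d, hcd⟩ : IsCoprime m p :=
          ((Nat.prime_iff_prime_int.mp hp).coprime_iff_not_dvd.mpr hpm).symm
        apply haF
        have h1 : a = (a ^ m) ^ c * (a ^ p) ^ d := by
          rw [← zpow_natCast a p, ← zpow_mul, ← zpow_mul, ← zpow_add, mul_comm m, mul_comm (p : ℤ),
            hcd, zpow_one]
        rw [h1]
        exact mul_mem (zpow_mem ham c) (zpow_mem (hG.pow_mem_frattini a) d)
  obtain ⟨u, hu, hu', huF⟩ := key h hz₁
  obtain ⟨v, hv, hv', -⟩ := key h.symm hz₂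
  apply huF
  have huv : (v : G ⧸ frattini G) = u := by
    have h1 := hL v u (hv'.trans hu'.symm)
    rw [← QuotientGroup.eq_one_iff, QuotientGroup.mk_mul, QuotientGroup.mk_inv,
      mul_inv_eq_one] at h1
    exact h1
  rw [← QuotientGroup.eq_one_iff]
  exact h.eq_one (mk_mem_beauvilleSigma _ hu) (huv ▸ mk_mem_beauvilleSigma _ hv)

end Beauville

/-! ### Groups of exponent two and three -/

section SmallExponent

variable {G : Type*} [Group G]

lemma not_isBeauvilleGroup_of_sq_eq_one [Nontrivial G] (hG : ∀ g : G, g ^ 2 = 1) :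
    ¬ IsBeauvilleGroup G := by
  rintro ⟨x, y, x', y', h⟩
  have hinv : ∀ g : G, g⁻¹ = g := fun g => inv_eq_of_mul_eq_one_left (by rw [← pow_two, hG])
  have hc : Commute x y := by
    have h1 := hinv (x * y)
    rw [mul_inv_rev, hinv, hinv] at h1
    exact h1.symm
  have hz : ∀ (a : G) (i : ℤ), a ^ i = 1 ∨ a ^ i = a := fun a i => by
    obtain ⟨k, rfl | rfl⟩ := Int.even_or_odd' i <;> simp [zpow_add, zpow_mul, hG]
  have hx' : x' ≠ 1 := fun h1 => h.symm.one_notMem (by simp [h1])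
  apply hx'
  refine h.eq_one ?_ (by simpa using zpow_mem_beauvilleSigma (a := x') (by simp) 1)
  have hmem : ∀ a ∈ ({x, y, x * y} : Set G), a ∈ beauvilleSigma x y := fun a ha => by
    simpa using zpow_mem_beauvilleSigma ha 1
  obtain ⟨i, j, hij⟩ := hc.exists_zpow_mul_zpow h.1 x'
  rw [hij]
  rcases hz x i with h1 | h1 <;> rcases hz y j with h2 | h2 <;> rw [h1, h2]
  · simpa using one_mem_beauvilleSigma x y
  · exact hmem _ (by simp)
  · exact hmem _ (by simp)
  · exact hmem _ (by simp)

lemma zpow_eq_of_pow_three_eq_one {a : G} (ha : a ^ 3 = 1) (i : ℤ) :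
    a ^ i = 1 ∨ a ^ i = a ∨ a ^ i = a⁻¹ := by
  have ha' : a ^ (3 : ℤ) = 1 := by exact_mod_cast ha
  obtain h | h | h : i = 3 * (i / 3) ∨ i = 3 * (i / 3) + 1 ∨ i = 3 * (i / 3 + 1) - 1 := by omega
  · left; rw [h, zpow_mul, ha', one_zpow]
  · right; left; rw [h, zpow_add, zpow_mul, ha', one_zpow, zpow_one, one_mul]
  · right; right; rw [h, zpow_sub, zpow_mul, ha', one_zpow, zpow_one, one_mul]

/-- In a group of exponent `3`, every element commutes with its conjugates. -/
lemma commute_commutatorElement_left (hG : ∀ g : G, g ^ 3 = 1) (x y : G) : Commute x ⁅x, y⁆ := by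
  have hsq : ∀ g : G, g * g = g⁻¹ := fun g =>
    eq_inv_of_mul_eq_one_left (by rw [← hG g, pow_succ, pow_two])
  have hxyx : ∀ x y : G, x * y * x = y⁻¹ * x⁻¹ * y⁻¹ := fun x y => by
    have h := hsq (x * y)
    rw [mul_inv_rev] at h
    rw [← h]; group
  -- `x` commutes with `y x y⁻¹`
  have h1 : x * (y * x * y⁻¹) = y * x * y⁻¹ * x := by
    have e1 : x * (y * x * y⁻¹) = y⁻¹ * x⁻¹ * y := by
      calc x * (y * x * y⁻¹) = x * y * x * y⁻¹ := by group
        _ = y⁻¹ * x⁻¹ * (y * y)⁻¹ := by rw [hxyx]; group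
        _ = y⁻¹ * x⁻¹ * y := by rw [hsq, inv_inv]
    have e2 : y * x * y⁻¹ * x = y⁻¹ * x⁻¹ * y := by
      calc y * x * y⁻¹ * x = y * (x * y⁻¹ * x) := by group
        _ = y * y * x⁻¹ * y := by rw [hxyx, inv_inv]; group
        _ = y⁻¹ * x⁻¹ * y := by rw [hsq]
    rw [e1, e2]
  have h2 : Commute x (y * x * y⁻¹) := h1
  have h3 : ⁅x, y⁆ = x * (y * x * y⁻¹)⁻¹ := by simp only [commutatorElement_def]; group
  rw [h3]
  exact (Commute.refl x).mul_right h2.inv_right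

lemma commute_commutatorElement_of_closure (hG : ∀ g : G, g ^ 3 = 1) {x y : G}
    (hxy : Subgroup.closure {x, y} = ⊤) (h : G) : Commute h ⁅x, y⁆ := by
  have hh : h ∈ Subgroup.closure {x, y} := hxy ▸ Subgroup.mem_top h
  induction hh using Subgroup.closure_induction with
  | mem a ha =>
    rcases ha with rfl | rfl
    · exact commute_commutatorElement_left hG _ _
    · rw [← commutatorElement_inv]
      exact (commute_commutatorElement_left hG _ _).inv_right
  | one => exact Commute.one_left _
  | mul a b _ _ ha hb => exact ha.mul_left hb
  | inv a _ ha => exact ha.inv_left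

/-- In a group of exponent `3` generated by `x` and `y`, every element lies in `Σ(x, y)` or in the
abelian subgroup generated by `x y⁻¹` and the central element `[x, y]`. The reason is that
modulo `⟨[x, y]⟩` there are four cyclic subgroups of order at most `3`, those of `x`, `y`, `xy` and
`x y⁻¹`, and that the conjugates of `x`, `y` and `xy` are their full cosets of `⟨[x, y]⟩`. -/
lemma mem_beauvilleSigma_or_of_pow_three (hG : ∀ g : G, g ^ 3 = 1) {x y : G}
    (hxy : Subgroup.closure {x, y} = ⊤) (g : G) :
    g ∈ beauvilleSigma x y ∨ ∃ i k : ℤ, g = (x * y⁻¹) ^ i * ⁅x, y⁆ ^ k := by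
  have hcc := commute_commutatorElement_of_closure hG hxy
  have hxyc : x * y = ⁅x, y⁆ * (y * x) := by simp only [commutatorElement_def]; group
  have hc3 := hG ⁅x, y⁆
  obtain ⟨c, hc⟩ : ∃ c, c = ⁅x, y⁆ := ⟨_, rfl⟩
  rw [← hc] at hcc hxyc hc3 ⊢
  have hN : (Subgroup.zpowers c).Normal := ⟨by
    rintro _ ⟨k, rfl⟩ h
    exact ⟨k, by rw [((hcc h).zpow_right k).eq, mul_inv_cancel_right]⟩⟩
  -- normal form of the elements
  obtain ⟨i, j, k, hg⟩ : ∃ i j k : ℤ, g = x ^ i * y ^ j * c ^ k := by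
    have hcomm : Commute (x : G ⧸ Subgroup.zpowers c) (y : G ⧸ Subgroup.zpowers c) :=
      commutatorElement_eq_one_iff_commute.mp
        ((QuotientGroup.eq_one_iff ⁅x, y⁆).mpr (hc ▸ Subgroup.mem_zpowers c))
    obtain ⟨i, j, hij⟩ := hcomm.exists_zpow_mul_zpow (closure_mk_pair_eq_top _ hxy) g
    obtain ⟨k, hk⟩ := (QuotientGroup.eq (a := x ^ i * y ^ j) (b := g)).mp hij.symm
    exact ⟨i, j, k, by rw [← mul_inv_cancel_left (x ^ i * y ^ j) g, ← hk]⟩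
  -- the conjugates of `a` fill the coset of `⟨c⟩`
  have hx1 : y⁻¹ * x * y = x * c := by
    rw [mul_assoc, hxyc, ← mul_assoc c, ← (hcc y).eq, mul_assoc, inv_mul_cancel_left, (hcc x).eq]
  have hy1 : x * y * x⁻¹ = y * c := by
    rw [hxyc, (hcc y).eq, ← mul_assoc, mul_inv_cancel_right]
  have hconj : ∀ a ∈ ({x, y, x * y} : Set G), ∃ t : G, t⁻¹ * a * t = a * c := by
    rintro a (rfl | rfl | rfl)
    · exact ⟨y, hx1⟩
    · exact ⟨x⁻¹, by rw [inv_inv, hy1]⟩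
    · exact ⟨x⁻¹, by rw [inv_inv, mul_assoc x y c, ← hy1]; group⟩
  have hcoset : ∀ a ∈ ({x, y, x * y} : Set G), ∀ k : ℤ, a * c ^ k ∈ beauvilleSigma x y ∧
      a⁻¹ * c ^ k ∈ beauvilleSigma x y := by
    intro a ha
    obtain ⟨t, ht⟩ := hconj a ha
    have key : ∀ k : ℤ, ∃ s : G, s⁻¹ * a * s = a * c ^ k := by
      intro k
      rcases zpow_eq_of_pow_three_eq_one hc3 k with h | h | h <;> rw [h]
      · exact ⟨1, by simp⟩
      · exact ⟨t, ht⟩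
      · refine ⟨t⁻¹, ?_⟩
        have h1 : a = t * a * t⁻¹ * c := by
          rw [mul_assoc (t * a), (hcc t⁻¹).eq, ← mul_assoc, mul_assoc t, ← ht]
          group
        rw [inv_inv, eq_mul_inv_iff_mul_eq]
        exact h1.symm
    intro k
    constructor
    · obtain ⟨s, hs⟩ := key k
      rw [← hs]
      simpa using conj_zpow_mem_beauvilleSigma ha 1 s
    · obtain ⟨s, hs⟩ := key (-k)
      have h1 : a⁻¹ * c ^ k = s⁻¹ * a ^ (-1 : ℤ) * s := by
        rw [(((hcc a).inv_left).zpow_right k).eq, ← inv_inj, mul_inv_rev, inv_inv, ← zpow_neg, ← hs]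
        group
      rw [h1]
      exact conj_zpow_mem_beauvilleSigma ha (-1) s
  rw [hg]
  rcases zpow_eq_of_pow_three_eq_one (hG x) i with hi | hi | hi <;>
  rcases zpow_eq_of_pow_three_eq_one (hG y) j with hj | hj | hj <;> rw [hi, hj]
  · exact Or.inr ⟨0, k, by simp⟩
  · exact Or.inl (by simpa using (hcoset y (by simp) k).1)
  · exact Or.inl (by simpa using (hcoset y (by simp) k).2)
  · exact Or.inl (by simpa using (hcoset x (by simp) k).1)
  · exact Or.inl (hcoset (x * y) (by simp) k).1
  · exact Or.inr ⟨1, k, by simp⟩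
  · exact Or.inl (by simpa using (hcoset x (by simp) k).2)
  · refine Or.inr ⟨-1, k - 1, ?_⟩
    have h1 : x⁻¹ * y = (x * y⁻¹) ^ (-1 : ℤ) * c⁻¹ := by
      have h2 : y⁻¹ * x⁻¹ * y = (x * c)⁻¹ := by rw [← hx1]; group
      rw [(hcc x).eq, mul_inv_rev] at h2
      rw [zpow_neg_one, mul_inv_rev, inv_inv, mul_assoc, ← h2]
      group
    rw [h1, mul_assoc, ← zpow_neg_one c, ← zpow_add, neg_add_eq_sub]
  · refine Or.inl ?_
    have h1 : x⁻¹ * y⁻¹ = (x * y)⁻¹ * c := by rw [hc]; simp only [commutatorElement_def]; group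
    rw [h1, mul_assoc, ← zpow_one_add]
    exact (hcoset (x * y) (by simp) _).2

lemma not_isBeauvilleGroup_of_pow_three_eq_one [Nontrivial G] (hG : ∀ g : G, g ^ 3 = 1) :
    ¬ IsBeauvilleGroup G := by
  rintro ⟨x, y, x', y', h⟩
  have hx' : x' ≠ 1 := fun h1 => h.symm.one_notMem (by simp [h1])
  have hy' : y' ≠ 1 := fun h1 => h.symm.one_notMem (by simp [h1])
  have hx : x ≠ 1 := fun h1 => h.one_notMem (by simp [h1])
  have hself : ∀ a ∈ ({x', y', x' * y'} : Set G), a ∈ beauvilleSigma x' y' := fun a ha => by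
    simpa using zpow_mem_beauvilleSigma ha 1
  obtain ⟨i, k, hik⟩ := (mem_beauvilleSigma_or_of_pow_three hG h.1 x').resolve_left
    fun h1 => hx' (h.eq_one h1 (hself _ (by simp)))
  obtain ⟨j, l, hjl⟩ := (mem_beauvilleSigma_or_of_pow_three hG h.1 y').resolve_left
    fun h1 => hy' (h.eq_one h1 (hself _ (by simp)))
  have hcc := commute_commutatorElement_of_closure hG h.1
  have hcomm : Commute x' y' := by
    rw [hik, hjl]
    exact (((Commute.refl _).zpow_zpow i j).mul_right ((hcc _).zpow_right l)).mul_left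
      ((hcc _).symm.zpow_left k)
  obtain ⟨a, b, hxab⟩ := hcomm.exists_zpow_mul_zpow h.2.1 x
  obtain ⟨a', b', hyab⟩ := hcomm.exists_zpow_mul_zpow h.2.1 y
  have hc1 : ⁅x, y⁆ = 1 := by
    rw [commutatorElement_eq_one_iff_commute, hxab, hyab]
    exact (((Commute.refl _).zpow_zpow a a').mul_right (hcomm.zpow_zpow a b')).mul_left
      ((hcomm.symm.zpow_zpow b a').mul_right ((Commute.refl _).zpow_zpow b b'))
  rw [hc1, one_zpow, mul_one] at hik hjl
  -- now `G` is cyclic, generated by `x y⁻¹`, hence also by `x`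
  set d := x * y⁻¹
  have hxd : x = d ^ (i * a + j * b) := by rw [zpow_add, zpow_mul, zpow_mul, ← hik, ← hjl, ← hxab]
  obtain ⟨m, hm⟩ : ∃ m : ℤ, d = x ^ m := by
    rcases zpow_eq_of_pow_three_eq_one (hG d) (i * a + j * b) with h1 | h1 | h1
    · exact absurd (hxd.trans h1) hx
    · exact ⟨1, by rw [zpow_one, hxd, h1]⟩
    · exact ⟨-1, by rw [zpow_neg_one, hxd, h1, inv_inv]⟩
  refine hx' (h.eq_one ?_ (hself _ (by simp)))
  rw [hik, hm, ← zpow_mul]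
  exact zpow_mem_beauvilleSigma (by simp) _

end SmallExponent

/-! ### Elementary abelian groups of rank two -/

section ElementaryAbelian

/-- Catanese's construction in `C_p × C_p` for `p ≥ 5`: the six elements `x`, `y`, `xy`, `x y²`,
`x y⁻¹`, `x² y` generate different subgroups except possibly for two of the same triple, as the
determinants of their exponent vectors are `±1` or `±2`; and `x y²`, `x y⁻¹` generate since the
corresponding determinant is `-3`. -/
lemma isBeauvilleStructure_of_commGroup {Q : Type*} [CommGroup Q] {p : ℕ} (hp : p.Prime)
    (hp5 : 5 ≤ p) {x y : Q} (hQ : ∀ g : Q, g ^ p = 1) (hxy : Subgroup.closure {x, y} = ⊤)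
    (hind : ∀ i j : ℤ, x ^ i * y ^ j = 1 → (p : ℤ) ∣ i ∧ (p : ℤ) ∣ j) :
    IsBeauvilleStructure x y (x * y ^ (2 : ℤ)) (x * y ^ (-1 : ℤ)) := by
  have hpi : Prime (p : ℤ) := Nat.prime_iff_prime_int.mp hp
  refine isBeauvilleStructure_iff.mpr ⟨hxy, ?_, ?_⟩
  · set K := Subgroup.closure {x * y ^ (2 : ℤ), x * y ^ (-1 : ℤ)}
    have h1 : x * y ^ (2 : ℤ) ∈ K := Subgroup.subset_closure (by simp)
    have h2 : x * y ^ (-1 : ℤ) ∈ K := Subgroup.subset_closure (by simp)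
    have h3 : y ^ (3 : ℤ) ∈ K := by
      have h := mul_mem h1 (inv_mem h2)
      convert h using 1
      rw [mul_inv_rev, ← zpow_neg, mul_comm x, mul_assoc, mul_comm (y ^ _) x⁻¹,
        mul_inv_cancel_left, ← zpow_add]
      norm_num
    have hnd : ¬ (p : ℤ) ∣ 3 := fun h => by
      have := Int.le_of_dvd (by norm_num) h
      omega
    obtain ⟨u, v, huv⟩ : IsCoprime (3 : ℤ) p := (hpi.coprime_iff_not_dvd.mpr hnd).symm
    have hy : y ∈ K := by
      have h4 : y = (y ^ (3 : ℤ)) ^ u := by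
        conv_lhs => rw [← zpow_one y, ← huv, zpow_add, mul_comm u, mul_comm v, zpow_mul,
          zpow_mul, zpow_natCast, hQ, one_zpow, mul_one]
      rw [h4]
      exact zpow_mem h3 u
    have hx : x ∈ K := by
      have h := mul_mem h1 (inv_mem (zpow_mem hy 2))
      rwa [mul_inv_cancel_right] at h
    rw [← top_le_iff, ← hxy, Subgroup.closure_le]
    rintro _ (rfl | rfl) <;> assumption
  · intro z hz₁ hz₂
    obtain ⟨a, ha, i, g, hz⟩ := mem_beauvilleSigma.mp hz₁
    obtain ⟨b, hb, j, g', hz'⟩ := mem_beauvilleSigma.mp hz₂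
    rw [mul_comm g⁻¹, inv_mul_cancel_right] at hz
    rw [mul_comm g'⁻¹, inv_mul_cancel_right] at hz'
    obtain ⟨α, β, hab, rfl⟩ : ∃ α β : ℤ,
        (α = 1 ∧ β = 0 ∨ α = 0 ∧ β = 1 ∨ α = 1 ∧ β = 1) ∧ a = x ^ α * y ^ β := by
      rcases ha with rfl | rfl | rfl
      · exact ⟨1, 0, by simp, by simp⟩
      · exact ⟨0, 1, by simp, by simp⟩
      · exact ⟨1, 1, by simp, by simp⟩
    obtain ⟨μ, δ, hcd, rfl⟩ : ∃ μ δ : ℤ,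
        (μ = 1 ∧ δ = 2 ∨ μ = 1 ∧ δ = -1 ∨ μ = 2 ∧ δ = 1) ∧ b = x ^ μ * y ^ δ := by
      rcases hb with rfl | rfl | rfl
      · exact ⟨1, 2, by simp, by simp⟩
      · exact ⟨1, -1, by simp, by simp⟩
      · refine ⟨2, 1, by simp, ?_⟩
        rw [mul_mul_mul_comm, ← zpow_add, zpow_two]
        norm_num
    have h1 : x ^ (α * i - μ * j) * y ^ (β * i - δ * j) = 1 := by
      have h := hz.symm.trans hz'
      rw [mul_zpow, mul_zpow, ← zpow_mul, ← zpow_mul, ← zpow_mul, ← zpow_mul] at h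
      rw [zpow_sub, zpow_sub, mul_mul_mul_comm, h, mul_mul_mul_comm]
      simp
    obtain ⟨h2, h3⟩ := hind _ _ h1
    have h4 : (p : ℤ) ∣ i * (α * δ - β * μ) := by
      have h := (h2.mul_left δ).sub (h3.mul_left μ)
      rwa [show δ * (α * i - μ * j) - μ * (β * i - δ * j) = i * (α * δ - β * μ) by ring] at h
    have h5 : ¬ (p : ℤ) ∣ α * δ - β * μ := by
      intro h
      have hle := fun h0 => Int.le_of_dvd (b := |α * δ - β * μ|) (abs_pos.mpr h0)
        ((dvd_abs _ _).mpr h)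
      rcases hab with ⟨rfl, rfl⟩ | ⟨rfl, rfl⟩ | ⟨rfl, rfl⟩ <;>
      rcases hcd with ⟨rfl, rfl⟩ | ⟨rfl, rfl⟩ | ⟨rfl, rfl⟩ <;>
      · have := hle (by norm_num)
        norm_num at this
        omega
    obtain ⟨k, rfl⟩ := (hpi.dvd_or_dvd h4).resolve_right h5
    rw [hz, zpow_mul, zpow_natCast, hQ, one_zpow]

end ElementaryAbelian

/-! ### Beauville groups with a good top power map -/

section TopPowerKernel

variable {G : Type*} [Group G] {p i : ℕ}

/-- In a semi-`p ^ i`-abelian group, the subgroup of the elements of order dividing `p ^ i`. -/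
def IsSemiPrimePowAbelian.ker (h : IsSemiPrimePowAbelian p i G) : Subgroup G where
  carrier := {x | x ^ p ^ i = 1}
  one_mem' := one_pow _
  mul_mem' := fun {x y} hx hy => by
    have h1 := (h x y⁻¹).mp (hx.out.trans (by rw [inv_pow, hy.out, inv_one]))
    simpa using h1
  inv_mem' := fun {x} hx => by simpa using hx

lemma IsSemiPrimePowAbelian.mem_ker (h : IsSemiPrimePowAbelian p i G) {x : G} :
    x ∈ h.ker ↔ x ^ p ^ i = 1 := Iff.rfl

instance IsSemiPrimePowAbelian.ker_normal (h : IsSemiPrimePowAbelian p i G) : h.ker.Normal :=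
  ⟨fun x hx g => by rw [h.mem_ker, conj_pow, h.mem_ker.mp hx]; simp⟩

lemma IsSemiPrimePowAbelian.mk_eq_mk_iff (h : IsSemiPrimePowAbelian p i G) {x y : G} :
    (x : G ⧸ h.ker) = y ↔ x ^ p ^ i = y ^ p ^ i := by
  rw [h x y, ← h.mem_ker, ← mul_inv_eq_one, ← QuotientGroup.mk_inv, ← QuotientGroup.mk_mul,
    QuotientGroup.eq_one_iff]

lemma IsSemiPrimePowAbelian.isBeauvilleGroup_quotient (h : IsSemiPrimePowAbelian p i G)
    (hB : IsBeauvilleGroup G) : IsBeauvilleGroup (G ⧸ h.ker) := by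
  obtain ⟨x₁, y₁, x₂, y₂, hs⟩ := hB
  refine ⟨x₁, y₁, x₂, y₂, isBeauvilleStructure_iff.mpr ⟨closure_mk_pair_eq_top _ hs.1,
    closure_mk_pair_eq_top _ hs.2.1, fun z hz₁ hz₂ => ?_⟩⟩
  obtain ⟨u, hu, rfl⟩ := exists_mk_of_mem_beauvilleSigma _ hz₁
  obtain ⟨v, hv, hvu⟩ := exists_mk_of_mem_beauvilleSigma _ hz₂
  rw [h.mk_eq_mk_iff] at hvu
  rw [QuotientGroup.eq_one_iff, h.mem_ker]
  exact hs.eq_one (pow_mem_beauvilleSigma hu _) (hvu ▸ pow_mem_beauvilleSigma hv _)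

/-- The quotient by the kernel of the `p ^ i`-th power map has exponent `p`, so it is not a
Beauville group for `p = 2, 3`. -/
lemma IsSemiPrimePowAbelian.five_le [Fact p.Prime] (h : IsSemiPrimePowAbelian p i G)
    (hexp : ∀ g : G, g ^ p ^ (i + 1) = 1) (hexp' : ∃ g : G, g ^ p ^ i ≠ 1)
    (hB : IsBeauvilleGroup G) : 5 ≤ p := by
  have hp : p.Prime := Fact.out
  have hQ : ∀ g : G ⧸ h.ker, g ^ p = 1 := by
    intro g
    induction g using QuotientGroup.induction_on with | H g
    refine (QuotientGroup.eq_one_iff (g ^ p)).mpr (h.mem_ker.mpr ?_)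
    rw [← pow_mul, ← pow_succ', hexp]
  have hnt : Nontrivial (G ⧸ h.ker) := by
    obtain ⟨g, hg⟩ := hexp'
    exact ⟨⟨g, 1, fun h1 => hg ((QuotientGroup.eq_one_iff g).mp h1)⟩⟩
  have hBQ := h.isBeauvilleGroup_quotient hB
  have h2 : p ≠ 2 := by
    rintro rfl
    exact not_isBeauvilleGroup_of_sq_eq_one hQ hBQ
  have h3 : p ≠ 3 := by
    rintro rfl
    exact not_isBeauvilleGroup_of_pow_three_eq_one hQ hBQ
  have h4 : p ≠ 4 := fun h => by rw [h] at hp; norm_num at hp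
  have := hp.two_le
  omega

variable [Finite G] [Fact p.Prime]

lemma card_powerSubgroup_le {n : ℕ} {b : G} (hb : (b ^ n) ^ p = 1)
    (h : ∀ g : G, ∃ k : ℤ, g ^ n = (b ^ n) ^ k) : Nat.card (powerSubgroup G n) ≤ p := by
  have hp : p.Prime := Fact.out
  have hle : powerSubgroup G n ≤ Subgroup.zpowers (b ^ n) := by
    rw [powerSubgroup, Subgroup.closure_le]
    rintro _ ⟨g, rfl⟩
    obtain ⟨k, hk⟩ := h g
    exact ⟨k, hk.symm⟩
  calc Nat.card (powerSubgroup G n) ≤ Nat.card (Subgroup.zpowers (b ^ n)) :=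
        Nat.card_le_card_of_injective _ (Subgroup.inclusion_injective hle)
    _ = orderOf (b ^ n) := Nat.card_zpowers _
    _ ≤ p := Nat.le_of_dvd hp.pos (orderOf_dvd_of_pow_eq_one hb)

/-- If `p ≥ 5` and `G` is a `2`-generator `p`-group of exponent dividing `p ^ (i + 1)` for which
`G ^ (p ^ i)` has order at least `p ^ 2`, then `G / Φ(G)` is a Beauville group. -/
lemma exists_isBeauvilleStructure_frattini (hG : IsPGroup p G) (hp5 : 5 ≤ p)
    (h2 : ∃ a b : G, Subgroup.closure {a, b} = ⊤)
    (hexp : ∀ g : G, g ^ p ^ (i + 1) = 1) (hV : p ^ 2 ≤ Nat.card (powerSubgroup G (p ^ i))) :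
    ∃ x₁ y₁ x₂ y₂ : G, IsBeauvilleStructure (x₁ : G ⧸ frattini G) (y₁ : G ⧸ frattini G)
      (x₂ : G ⧸ frattini G) (y₂ : G ⧸ frattini G) := by
  have hp : p.Prime := Fact.out
  obtain ⟨x, y, hxy⟩ := h2
  have hncyc : ∀ b : G, Subgroup.closure {1, b} ≠ ⊤ := by
    intro b hb
    rw [Subgroup.closure_insert_one, ← Subgroup.zpowers_eq_closure] at hb
    refine (hV.trans (card_powerSubgroup_le (b := b) (by rw [← pow_mul, ← pow_succ, hexp])
      fun g => ?_)).not_gt (by nlinarith [hp.two_le])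
    obtain ⟨k, rfl⟩ := Subgroup.mem_zpowers_iff.mp (hb ▸ Subgroup.mem_top g)
    exact ⟨k, by rw [← zpow_natCast, ← zpow_natCast, zpow_comm]⟩
  refine ⟨x, y, x * y ^ (2 : ℤ), x * y ^ (-1 : ℤ), ?_⟩
  let _ : CommGroup (G ⧸ frattini G) :=
    { (inferInstance : Group (G ⧸ frattini G)) with mul_comm := hG.mk_frattini_comm }
  refine isBeauvilleStructure_of_commGroup hp hp5 (fun g => ?_) (closure_mk_pair_eq_top _ hxy)
    fun k l hkl => ⟨?_, ?_⟩
  · induction g using QuotientGroup.induction_on with | H g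
    exact (QuotientGroup.eq_one_iff _).mpr (hG.pow_mem_frattini g)
  · by_contra hk
    exact hncyc y (hG.closure_pair_eq_top_of_not_dvd hxy (w := 1) (i := k) (j := l) hkl.symm hk)
  · by_contra hl
    rw [mul_comm] at hkl
    exact hncyc x (hG.closure_pair_eq_top_of_not_dvd (by rwa [Set.pair_comm]) (w := 1)
      (i := l) (j := k) hkl.symm hl)

/-- An element `w` of the kernel outside `Φ(G)` would give `G = ⟨w, z⟩` for some `z`, and then all
`p ^ i`-th powers would lie in the subgroup `⟨z ^ (p ^ i)⟩` of order at most `p`. -/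
lemma IsSemiPrimePowAbelian.ker_le_frattini (h : IsSemiPrimePowAbelian p i G)
    (hG : IsPGroup p G) (h2 : ∃ a b : G, Subgroup.closure {a, b} = ⊤)
    (hexp : ∀ g : G, g ^ p ^ (i + 1) = 1) (hV : p ^ 2 ≤ Nat.card (powerSubgroup G (p ^ i))) :
    h.ker ≤ frattini G := by
  intro w hw
  by_contra hwF
  obtain ⟨z, hz⟩ := hG.exists_closure_pair_eq_top h2 hwF
  -- modulo the kernel `G` is generated by `z`, so `G ^ (p ^ i)` is generated by `z ^ (p ^ i)`
  have hwk : (w : G ⧸ h.ker) = 1 := (QuotientGroup.eq_one_iff w).mpr hw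
  refine (hV.trans (card_powerSubgroup_le (b := z) (by rw [← pow_mul, ← pow_succ, hexp])
    fun g => ?_)).not_gt (by nlinarith [(Fact.out : p.Prime).two_le])
  obtain ⟨k, l, hkl⟩ := Commute.exists_zpow_mul_zpow (hwk ▸ Commute.one_left (z : G ⧸ h.ker))
    (closure_mk_pair_eq_top _ hz) g
  rw [hwk, one_zpow, one_mul, ← QuotientGroup.mk_zpow, h.mk_eq_mk_iff] at hkl
  exact ⟨l, by rw [hkl, ← zpow_natCast, ← zpow_natCast, zpow_comm]⟩

/-- A semi-`p ^ i`-abelian Beauville group of exponent `p ^ (i + 1)` has `p ^ i`-th powers that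
generate a subgroup of order at least `p ^ 2`: each of the two generating pairs contains an
element outside the kernel, and in a group of order `p` their powers generate the same subgroup. -/
lemma IsSemiPrimePowAbelian.prime_sq_le_card (h : IsSemiPrimePowAbelian p i G)
    (hG : IsPGroup p G) (hexp : ∃ g : G, g ^ p ^ i ≠ 1) (hB : IsBeauvilleGroup G) :
    p ^ 2 ≤ Nat.card (powerSubgroup G (p ^ i)) := by
  have hp : p.Prime := Fact.out
  obtain ⟨x₁, y₁, x₂, y₂, hs⟩ := hB
  refine (hG.prime_sq_le_card_or_card_dvd _).resolve_right fun hV => ?_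
  have key : ∀ x y : G, Subgroup.closure {x, y} = ⊤ →
      ∃ a ∈ ({x, y, x * y} : Set G), a ^ p ^ i ≠ 1 := by
    intro x y hxy
    by_contra! hxy1
    obtain ⟨g, hg⟩ := hexp
    have hle : Subgroup.closure {x, y} ≤ h.ker := by
      rw [Subgroup.closure_le]
      rintro a (rfl | rfl)
      · exact hxy1 _ (by simp)
      · exact hxy1 _ (by simp)
    exact hg (hle (hxy ▸ Subgroup.mem_top g))
  obtain ⟨a, ha, ha1⟩ := key x₁ y₁ hs.1
  obtain ⟨b, hb, hb1⟩ := key x₂ y₂ hs.2.1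
  have hcard : Nat.card (powerSubgroup G (p ^ i)) = p := by
    refine ((Nat.dvd_prime hp).mp hV).resolve_left fun h1 => ha1 ?_
    have := pow_mem_powerSubgroup a (p ^ i)
    rwa [Subgroup.card_eq_one.mp h1, Subgroup.mem_bot] at this
  have htop := zpowers_eq_top_of_prime_card (g := (⟨a ^ p ^ i, pow_mem_powerSubgroup a _⟩ :
    powerSubgroup G (p ^ i))) hcard (fun h1 => ha1 (congrArg Subtype.val h1))
  obtain ⟨k, hk⟩ := Subgroup.mem_zpowers_iff.mp (htop ▸ Subgroup.mem_top
    (⟨b ^ p ^ i, pow_mem_powerSubgroup b _⟩ : powerSubgroup G (p ^ i)))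
  have hk' : (a ^ p ^ i) ^ k = b ^ p ^ i := congrArg Subtype.val hk
  refine hb1 (hs.eq_one ?_ ?_)
  · rw [← hk', ← zpow_natCast a, ← zpow_mul]
    exact zpow_mem_beauvilleSigma ha _
  · rw [← zpow_natCast]
    exact zpow_mem_beauvilleSigma hb _

end TopPowerKernel

theorem theoremA (p : ℕ) (hp : p.Prime) (G : Type*) [Group G] [Finite G] (hG : IsPGroup p G)
    (h2 : ∃ a b : G, Subgroup.closure {a, b} = ⊤)
    (e : ℕ) (he : 1 ≤ e) (hexp : Monoid.exponent G = p ^ e)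
    (h : IsSemiPrimePowAbelian p (e - 1) G ∨ IsPotent p G) :
    (IsBeauvilleGroup G ↔ 5 ≤ p ∧ p ^ 2 ≤ Nat.card (powerSubgroup G (p ^ (e - 1)))) ∧
    (IsBeauvilleGroup G → ∀ x₁ y₁ x₂ y₂ : G,
      IsBeauvilleStructure (x₁ : G ⧸ frattini G) (y₁ : G ⧸ frattini G)
        (x₂ : G ⧸ frattini G) (y₂ : G ⧸ frattini G) →
      IsBeauvilleStructure x₁ y₁ x₂ y₂) := by
  have := Fact.mk hp
  obtain ⟨i, rfl⟩ : ∃ i, e = i + 1 := ⟨e - 1, by omega⟩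
  rw [Nat.add_sub_cancel] at h ⊢
  have hexp1 : ∀ g : G, g ^ p ^ (i + 1) = 1 := fun g => hexp ▸ Monoid.pow_exponent_eq_one g
  have hexp2 : ∃ g : G, g ^ p ^ i ≠ 1 := by
    by_contra! hall
    have h1 := Monoid.exponent_dvd_of_forall_pow_eq_one hall
    rw [hexp, Nat.pow_dvd_pow_iff_le_right hp.one_lt] at h1
    omega
  have hnt : Nontrivial G := by
    obtain ⟨g, hg⟩ := hexp2
    exact ⟨⟨g, 1, fun h1 => hg (by rw [h1, one_pow])⟩⟩
  suffices hmain : (IsBeauvilleGroup G → 5 ≤ p ∧ p ^ 2 ≤ Nat.card (powerSubgroup G (p ^ i))) ∧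
      (5 ≤ p → p ^ 2 ≤ Nat.card (powerSubgroup G (p ^ i)) →
        ∀ u v : G, u ^ p ^ i = v ^ p ^ i → u * v⁻¹ ∈ frattini G) by
    refine ⟨⟨hmain.1, fun hV => ?_⟩, fun hB x₁ y₁ x₂ y₂ hs =>
      hs.lift hG hexp1 (hmain.2 (hmain.1 hB).1 (hmain.1 hB).2)⟩
    obtain ⟨x₁, y₁, x₂, y₂, hs⟩ := exists_isBeauvilleStructure_frattini hG hV.1 h2 hexp1 hV.2
    exact ⟨x₁, y₁, x₂, y₂, hs.lift hG hexp1 (hmain.2 hV.1 hV.2)⟩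
  have hsemi : IsSemiPrimePowAbelian p i G ∨ (5 ≤ p ∧
      p ^ 2 ≤ Nat.card (powerSubgroup G (p ^ i)) ∧
      ∀ u v : G, u ^ p ^ i = v ^ p ^ i → u * v⁻¹ ∈ frattini G) :=
    h.elim Or.inl fun hpot => hpot.semi_or hG h2 hexp1
  rcases hsemi with hs | ⟨hp5, hV, hL⟩
  · exact ⟨fun hB => ⟨hs.five_le hexp1 hexp2 hB, hs.prime_sq_le_card hG hexp2 hB⟩,
      fun _ hV u v huv => hs.ker_le_frattini hG h2 hexp1 hV ((hs u v).mp huv)⟩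
  · exact ⟨fun _ => ⟨hp5, hV⟩, fun _ _ => hL⟩
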